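/- Let $G$ be a group, $\theta\subseteq\mathbb Z[G]$ a left ideal and $M=\mathbb Z[G]/\theta$. For a left $\mathbb Z[G]$-module $N$ let $N^\theta=\{x\in N:\theta x=0\}$. Let $(A,d)$ be a complex of left $\mathbb Z[G]$-modules with $A^i=0$ for $i>0$ and for $i\ll 0$, with $H^i(A)=0$ for $i\neq 0$, and with $H^0(A)$ torsion-free as an abelian group. Put $$I(A;\theta)=\frac{\#\operatorname{coker}\bigl(H^0(A^\theta)\to H^0(A)^\theta\bigr)}{\#\operatorname{tor}H^0(A^\theta)\cdot\prod_{i\ne0}\#H^i(A^\theta)^{(-1)^i}}$$ whenever the groups occurring here are finite, and write $H^p(\operatorname{Ext}^q_G(M,A))$ for the cohomology at $p$ of the complex $\cdots\to\operatorname{Ext}_G^q(M,A^p)\to\operatorname{Ext}_G^q(M,A^{p+1})\to\cdots$. Let $P_\bullet\to M$ be a projective resolution with differential $\partial$, and let $K^{p,q}=\operatorname{Hom}_G(P_q,A^p)$ be the double complex with differentials $d\circ$ and $(-1)^p\,\circ\partial$. Let $E_r^{p,q}$ be the spectral sequence of its total complex $K^n=\bigoplus_{p+q=n}K^{p,q}$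 with the filtration $\operatorname{Fil}^pK^n=\bigoplus_{p'\ge p}K^{p',n-p'}$. (1) If $G$ is finite and every $A^p$ is finitely generated, then $H^i(A^\theta)$ is finite for all $i\neq0$, and $H^p(\operatorname{Ext}_G^q(M,A))$ is finite for all $p$ and all $q>0$. (2) Suppose that $H^i(A^\theta)$ is finite for all $i\ne 0$, that $H^p(\operatorname{Ext}^q_G(M,A))$ is finite for all $p,q$ with $q>0$ and $p+q\le1$, and that $$\#\operatorname{Ext}^1_G(M,H^0(A))=\prod_{q\ge0}\#H^{1-q}(\operatorname{Ext}^q_G(M,A)).$$ Then $\operatorname{coker}(H^0(A^\theta)\to H^0(A)^\theta)$ and $\operatorname{tor}H^0(A^\theta)$ are finite and $$I(A;\theta)=\prod_{\substack{p+q\le0\\ q>0}}\#H^p(\operatorname{Ext}^q_G(M,A))^{(-1)^{p+q}}=\prod_{\substack{p+q\le0\\ q>0}}(\#E_2^{p,q})^{(-1)^{p+q}}.$$ -/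

import Mathlib

open CategoryTheory CategoryTheory.Limits

universe u

noncomputable section

namespace SinnottIndex

/-! ### The functor `N ↦ N^θ` -/

section Annihilated

variable {R : Type u} [Ring R] (θ : Ideal R)

/-- `N^θ`: the subgroup of the left module `N` annihilated by the left ideal `θ`. -/
def annihilated (N : Type u) [AddCommGroup N] [Module R N] : AddSubgroup N where
  carrier := {x | ∀ t ∈ θ, t • x = 0}
  zero_mem' := fun t _ => smul_zero t
  add_mem' := fun hx hy t ht => by rw [smul_add, hx t ht, hy t ht, add_zero]
  neg_mem' := fun hx t ht => by rw [smul_neg, hx t ht, neg_zero]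

/-- The map `N^θ → N'^θ` induced by a linear map `N → N'`. -/
def annihilatedMap {N N' : Type u} [AddCommGroup N] [Module R N] [AddCommGroup N'] [Module R N']
    (f : N →ₗ[R] N') : annihilated θ N →+ annihilated θ N' :=
  (f.toAddMonoidHom.comp (annihilated θ N).subtype).codRestrict (annihilated θ N')
    (fun x t ht => by
      have h : f (t • (x : N)) = t • f (x : N) := f.map_smul t (x : N)
      change t • f (x : N) = 0
      rw [← h, x.2 t ht, map_zero])

/-- The functor `N ↦ N^θ` from left modules to abelian groups. -/
def annFunctor : ModuleCat.{u} R ⥤ AddCommGrpCat.{u} where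
  obj N := AddCommGrpCat.of (annihilated θ N)
  map f := AddCommGrpCat.ofHom (annihilatedMap θ f.hom)

instance : (annFunctor θ).Additive where

/-- The inclusion `N^θ → N`. -/
def annInclusion : annFunctor θ ⟶ forget₂ (ModuleCat.{u} R) AddCommGrpCat.{u} where
  app N := AddCommGrpCat.ofHom (annihilated θ N).subtype

variable (A : CochainComplex (ModuleCat.{u} R) ℤ)

/-- The complex of abelian groups `A^θ`. -/
abbrev annComplex : CochainComplex AddCommGrpCat.{u} ℤ :=
  ((annFunctor θ).mapHomologicalComplex (ComplexShape.up ℤ)).obj A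

/-- The map `H^i(A^θ) → H^i(A)` induced by the inclusion of complexes `A^θ → A`. -/
def annHomologyToHomology (i : ℤ) :
    (annComplex θ A).homology i ⟶
      (forget₂ (ModuleCat.{u} R) AddCommGrpCat.{u}).obj (A.homology i) :=
  ShortComplex.homologyMap ((A.sc i).mapNatTrans (annInclusion θ)) ≫
    ((A.sc i).mapHomologyIso (forget₂ (ModuleCat.{u} R) AddCommGrpCat.{u})).hom

/-- Multiplication by a ring element, as an additive map natural in the module. -/
def smulNatTrans (t : R) :
    forget₂ (ModuleCat.{u} R) AddCommGrpCat.{u} ⟶ forget₂ (ModuleCat.{u} R) AddCommGrpCat.{u} where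
  app N := AddCommGrpCat.ofHom (DistribSMul.toAddMonoidHom N t)
  naturality _ _ f := by
    ext x
    exact (f.hom.map_smul t x).symm

lemma comp_conj_eq_zero {C : Type*} [Category C] [HasZeroMorphisms C] {X Y Z : C} (a : X ⟶ Y) (e : Y ≅ Z)
    (m : Y ⟶ Y) (s : Z ⟶ Z) (h : s = e.inv ≫ m ≫ e.hom) (h' : a ≫ m = 0) :
    (a ≫ e.hom) ≫ s = 0 := by
  rw [h, Category.assoc, Iso.hom_inv_id_assoc, ← Category.assoc, h', zero_comp]

lemma annHomologyToHomology_smul (i : ℤ) (t : R) (ht : t ∈ θ) (x : (annComplex θ A).homology i) :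
    t • (show A.homology i from (annHomologyToHomology θ A i).hom x) = 0 := by
  have h : annHomologyToHomology θ A i ≫ (smulNatTrans t).app (A.homology i) = 0 := by
    have h1 := NatTrans.app_homology (smulNatTrans t) (A.sc i)
    have h3 : ShortComplex.homologyMap ((A.sc i).mapNatTrans (annInclusion θ)) ≫
        ShortComplex.homologyMap ((A.sc i).mapNatTrans (smulNatTrans t)) = 0 := by
      rw [← ShortComplex.homologyMap_comp]
      have h4 : ∀ N : ModuleCat.{u} R, (annInclusion θ).app N ≫ (smulNatTrans t).app N = 0 := by
        intro N
        ext y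
        exact y.2 t ht
      have h5 : (A.sc i).mapNatTrans (annInclusion θ) ≫
          (A.sc i).mapNatTrans (smulNatTrans t) = 0 := by
        ext1
        · exact h4 _
        · exact h4 _
        · exact h4 _
      rw [h5, ShortComplex.homologyMap_zero]
    exact comp_conj_eq_zero _ _ _ _ h1 h3
  exact congrArg (fun f => f.hom x) h

/-- The canonical map `H^i(A^θ) → H^i(A)^θ`. -/
def annHomologyMap (i : ℤ) :
    (annComplex θ A).homology i →+ annihilated θ (A.homology i) :=
  AddMonoidHom.codRestrict (annHomologyToHomology θ A i).hom (annihilated θ (A.homology i))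
    (fun x t ht => annHomologyToHomology_smul θ A i t ht x)

/-- The cokernel of `H^0(A^θ) → H^0(A)^θ`. -/
abbrev indexCoker : Type u :=
  annihilated θ (A.homology 0) ⧸ (annHomologyMap θ A 0).range

/-- The torsion subgroup of `H^0(A^θ)`. -/
abbrev indexTor : AddSubgroup ((annComplex θ A).homology 0) :=
  AddCommGroup.torsion ((annComplex θ A).homology 0)

/-- `I(A;θ) = #coker(H^0(A^θ) → H^0(A)^θ) / (#tor H^0(A^θ) · ∏_{i ≠ 0} #H^i(A^θ)^{(-1)^i})`.
The formula is meaningful when the groups in it are finite. -/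
def index : ℚ :=
  (Nat.card (indexCoker θ A) : ℚ) /
    ((Nat.card (indexTor θ A) : ℚ) *
      ∏ᶠ (i : ℤ) (_ : i ≠ 0),
        (Nat.card ((annComplex θ A).homology i) : ℚ) ^ ((i.negOnePow : ℤˣ) : ℤ))

/-- The left module `R/θ`. -/
abbrev quotModule : ModuleCat.{u} R := ModuleCat.of R (R ⧸ θ)

end Annihilated

/-- `H^p(Ext^q(M, A))`: the cohomology in degree `p` of the complex
`⋯ → Ext^q(M, A^p) → Ext^q(M, A^{p+1}) → ⋯`. -/
abbrev cohExt {R : Type u} [Ring R] (M : ModuleCat.{u} R)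
    (A : CochainComplex (ModuleCat.{u} R) ℤ) (p : ℤ) (q : ℕ) : AddCommGrpCat.{u} :=
  (((Abelian.extFunctorObj M q).mapHomologicalComplex (ComplexShape.up ℤ)).obj A).homology p

/-! ### The first spectral sequence of the double complex `Hom(P_q, A^p)` -/

section SpectralSequence

variable {R : Type u} [Ring R] (P : ChainComplex (ModuleCat.{u} R) ℕ)
  (A : CochainComplex (ModuleCat.{u} R) ℤ)

/-- Families with components in `K^{p,q} = Hom(P_q, A^p)`. -/
abbrev Bigraded : Type u := ∀ x : ℤ × ℕ, (P.X x.2 ⟶ A.X x.1)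

/-- `D = d + δ`, where `d` is composition with the differential of `A` and `δ` is `(-1)^p` times
composition with the differential of `P`. (Here `P.d 0 (0 - 1) = P.d 0 0` is zero.) -/
def totalD : Bigraded P A →+ Bigraded P A where
  toFun f x := f (x.1 - 1, x.2) ≫ A.d (x.1 - 1) x.1 +
    ((x.1.negOnePow : ℤˣ) : ℤ) • (P.d x.2 (x.2 - 1) ≫ f (x.1, x.2 - 1))
  map_zero' := by
    funext x
    simp
  map_add' f g := by
    funext x
    simp only [Pi.add_apply, Preadditive.add_comp, Preadditive.comp_add, smul_add]
    abel

/-- `Fil^p K^n = ⨁_{p' ≥ p, p' + q = n} K^{p',q}`, a subgroup of `K^n = ⨁_{p' + q = n} K^{p',q}`. -/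
def fil (p n : ℤ) : AddSubgroup (Bigraded P A) where
  carrier := {f | {x | f x ≠ 0}.Finite ∧ ∀ x : ℤ × ℕ, f x ≠ 0 → p ≤ x.1 ∧ x.1 + x.2 = n}
  zero_mem' := by simp
  add_mem' := by
    rintro f g ⟨hf, hf'⟩ ⟨hg, hg'⟩
    have key : ∀ x, (f + g) x ≠ 0 → f x ≠ 0 ∨ g x ≠ 0 := by
      intro x hx
      by_contra! h
      exact hx (by rw [Pi.add_apply, h.1, h.2, add_zero])
    exact ⟨(hf.union hg).subset key, fun x hx => (key x hx).elim (hf' x) (hg' x)⟩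
  neg_mem' := by
    rintro f ⟨hf, hf'⟩
    exact ⟨by simpa using hf, by simpa using hf'⟩

/-- `Z_r^{p,n-p} = {f ∈ Fil^p K^n : D f ∈ Fil^{p+r} K^{n+1}}`. -/
def ssZ (r p n : ℤ) : AddSubgroup (Bigraded P A) :=
  fil P A p n ⊓ (fil P A (p + r) (n + 1)).comap (totalD P A)

/-- `B_r^{p,n-p} = Z_{r-1}^{p+1,n-p-1} + D Z_{r-1}^{p-r+1,n-p+r-2}`. -/
def ssB (r p n : ℤ) : AddSubgroup (Bigraded P A) :=
  ssZ P A (r - 1) (p + 1) n ⊔ (ssZ P A (r - 1) (p - r + 1) (n - 1)).map (totalD P A)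

/-- The term `E_r^{p,q} = Z_r^{p,q} / B_r^{p,q}` of the spectral sequence of the total complex
of the double complex `Hom(P_q, A^p)`, filtered by `Fil^p = ⨁_{p' ≥ p} K^{p',q}`. -/
abbrev ssE (r p q : ℤ) : Type u :=
  ssZ P A r p (p + q) ⧸ (ssB P A r p (p + q)).addSubgroupOf (ssZ P A r p (p + q))

end SpectralSequence

end SinnottIndex

end

/-! Write `K` for the total complex, `M` for `R/θ`, and `ε : A^0 → H^0(A)` for the projection. Since
the `P_q` are projective and `A` is bounded with cohomology only in degree 0, `K` computes `Ext^n(M,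
H^0(A))`; in particular its cohomology vanishes for `n < 0` and is `H^0(A)^θ` for `n = 0`
(`exists_totalD_eq`, `exists_cocycle_extending`). The subcomplex `Hom(M, A)` of `K` is `A^θ`. The
long exact sequence identifies `H^{i-1}(K/A^θ)` with `H^i(A^θ)` for `i < 0`, `H^{-1}` and `H^0` of
`K/A^θ` with the kernel and cokernel of `H^0(A^θ) → H^0(A)^θ`, and `H^1` with `Ext^1(M, H^0(A))`.
The kernel, once finite, is the torsion subgroup because `H^0(A)` is torsion-free. So the index is
the Euler characteristic of `K/A^θ` truncated to degrees `≤ 0`.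

To compute it, filter `K` by the décalage `dec q` of `Fil`. This starts with `dec 0 = A^θ`, exhausts
`K`, and its graded pieces have cohomology `E_2^{n-q,q}`, which is `H^{n-q}(Ext^q(M, A))` for `q >
0` (`card_ssE_two`, `card_ssE_two_eq_card_cohExt`). A truncated Euler characteristic is
multiplicative as soon as the connecting map from degree 0 to degree 1 vanishes. The order of `H^1`
is submultiplicative along the filtration; the hypothesis on `Ext^1` says that equality holds
overall, hence at every step, and this kills all those connecting maps (`altProd_filtration`).

For finite `G`, semisimplicity of `ℚ[G]` gives, after clearing denominators, `e ∈ R` and an integer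
`c ≠ 0` with `θe = 0` and `e ≡ c` modulo `θ`. Then `c` annihilates `Ext^q(M, -)` for `q > 0` and
`H^i(A^θ)` for `i ≠ 0`, and these groups are finitely generated. -/

noncomputable section

namespace SinnottIndex

/-! ### Subquotients of an abelian group -/

section Subquotient

variable {B : Type*} [AddCommGroup B]

/-- The quotient `Z / (Z ∩ N)` of two subgroups of an abelian group. -/
abbrev Subquot (Z N : AddSubgroup B) : Type _ := Z ⧸ N.addSubgroupOf Z

/-- The map of subquotients induced by an endomorphism. -/
def subquotMap (φ : B →+ B) {Z N Z' N' : AddSubgroup B} (hZ : ∀ z ∈ Z, φ z ∈ Z')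
    (hN : ∀ z ∈ N, φ z ∈ N') : Subquot Z N →+ Subquot Z' N' :=
  QuotientAddGroup.map _ _ ((φ.comp Z.subtype).codRestrict Z' fun z => hZ z z.2)
    fun z hz => hN z hz

lemma subquot_mk_eq_zero {Z N : AddSubgroup B} (z : Z) :
    (QuotientAddGroup.mk z : Subquot Z N) = 0 ↔ (z : B) ∈ N := by
  rw [QuotientAddGroup.eq_zero_iff, AddSubgroup.mem_addSubgroupOf]

lemma subquotMap_range_eq_ker {φ ψ : B →+ B} {Z₁ N₁ Z₂ N₂ Z₃ N₃ : AddSubgroup B}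
    (hZ : ∀ z ∈ Z₁, φ z ∈ Z₂) (hN : ∀ z ∈ N₁, φ z ∈ N₂)
    (hZ' : ∀ z ∈ Z₂, ψ z ∈ Z₃) (hN' : ∀ z ∈ N₂, ψ z ∈ N₃)
    (h : ∀ z ∈ Z₂, ψ z ∈ N₃ ↔ ∃ w ∈ Z₁, z - φ w ∈ N₂) :
    (subquotMap φ hZ hN).range = (subquotMap ψ hZ' hN').ker := by
  ext y
  obtain ⟨⟨z, hz⟩, rfl⟩ := QuotientAddGroup.mk_surjective y
  rw [AddMonoidHom.mem_ker]
  trans ψ z ∈ N₃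
  · rw [h z hz]
    constructor
    · rintro ⟨x, hx⟩
      obtain ⟨⟨w, hw⟩, rfl⟩ := QuotientAddGroup.mk_surjective x
      refine ⟨w, hw, ?_⟩
      have h1 : (QuotientAddGroup.mk (⟨z, hz⟩ - ⟨φ w, hZ w hw⟩) : Subquot Z₂ N₂) = 0 := by
        rw [QuotientAddGroup.mk_sub, ← hx]
        exact sub_self _
      exact (subquot_mk_eq_zero _).1 h1
    · rintro ⟨w, hw, h1⟩
      refine ⟨QuotientAddGroup.mk ⟨w, hw⟩, ?_⟩
      have h2 : (QuotientAddGroup.mk (⟨z, hz⟩ - ⟨φ w, hZ w hw⟩) : Subquot Z₂ N₂) = 0 :=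
        (subquot_mk_eq_zero _).2 h1
      rw [QuotientAddGroup.mk_sub, sub_eq_zero] at h2
      exact h2.symm
  · exact (subquot_mk_eq_zero (⟨ψ z, hZ' z hz⟩ : Z₃)).symm

/-- No finiteness is needed, as `Nat.card` of an infinite group is 0. Finiteness is later read off
from cardinalities being nonzero. -/
lemma card_eq_card_range_mul_card_range {X Y Z : Type*} [AddCommGroup X] [AddCommGroup Y]
    [AddCommGroup Z] (f : X →+ Y) (g : Y →+ Z) (h : f.range = g.ker) :
    Nat.card Y = Nat.card f.range * Nat.card g.range := by
  rw [AddSubgroup.card_eq_card_quotient_mul_card_addSubgroup f.range, mul_comm]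
  congr 1
  rw [h]
  exact Nat.card_congr (QuotientAddGroup.quotientKerEquivRange g).toEquiv

end Subquotient

/-! ### Relative cohomology and the long exact sequence of a triple -/

section RelativeCohomology

variable {B : Type*} [AddCommGroup B] (D : B →+ B)

/-- Relative cocycles of a pair of families of subgroups. -/
def relZ (S S' : ℤ → AddSubgroup B) (n : ℤ) : AddSubgroup B :=
  S' n ⊓ (S (n + 1)).comap D

/-- Relative coboundaries of a pair of families of subgroups. -/
def relB (S S' : ℤ → AddSubgroup B) (n : ℤ) : AddSubgroup B :=
  S n ⊔ (S' (n - 1)).map D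

/-- Relative cohomology of a pair of families of subgroups. -/
abbrev RelH (S S' : ℤ → AddSubgroup B) (n : ℤ) : Type _ :=
  Subquot (relZ D S S' n) (relB D S S' n)

variable {D}

lemma mem_relZ {S S' : ℤ → AddSubgroup B} {n : ℤ} {x : B} :
    x ∈ relZ D S S' n ↔ x ∈ S' n ∧ D x ∈ S (n + 1) := Iff.rfl

lemma mem_relB {S S' : ℤ → AddSubgroup B} {n : ℤ} {x : B} :
    x ∈ relB D S S' n ↔ ∃ s ∈ S n, ∃ t ∈ S' (n - 1), s + D t = x := by
  simp [relB, AddSubgroup.mem_sup]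

/-- The orders of the groups in the long exact sequence of a triple, in terms of the orders of the
images of the three maps. -/
theorem exists_card_relH (hD : ∀ x, D (D x) = 0) {S S' S'' : ℤ → AddSubgroup B}
    (h₁ : ∀ n, S n ≤ S' n) (h₂ : ∀ n, S' n ≤ S'' n) :
    ∃ a b c : ℤ → ℕ, ∀ n,
      Nat.card (RelH D S S' n) = c (n - 1) * a n ∧
      Nat.card (RelH D S S'' n) = a n * b n ∧
      Nat.card (RelH D S' S'' n) = b n * c n := by
  let f (n : ℤ) : RelH D S S' n →+ RelH D S S'' n := subquotMap (AddMonoidHom.id B)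
    (fun z hz => ⟨h₂ n hz.1, hz.2⟩)
    (fun z hz => by
      obtain ⟨s, hs, t, ht, rfl⟩ := mem_relB.1 hz
      exact mem_relB.2 ⟨s, hs, t, h₂ _ ht, rfl⟩)
  let g (n : ℤ) : RelH D S S'' n →+ RelH D S' S'' n := subquotMap (AddMonoidHom.id B)
    (fun z hz => ⟨hz.1, h₁ _ hz.2⟩)
    (fun z hz => by
      obtain ⟨s, hs, t, ht, rfl⟩ := mem_relB.1 hz
      exact mem_relB.2 ⟨s, h₁ _ hs, t, ht, rfl⟩)
  -- The target degree is a separate variable because `n - 1 + 1` is not definitionally `n`.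
  let d (m n : ℤ) (h : m + 1 = n) : RelH D S' S'' m →+ RelH D S S' n := subquotMap D
    (fun z hz => by
      subst h
      exact ⟨hz.2, by simp [hD]⟩)
    (fun z hz => by
      subst h
      obtain ⟨s, hs, t, ht, rfl⟩ := mem_relB.1 hz
      exact mem_relB.2 ⟨0, zero_mem _, s, by simpa using hs, by simp [hD]⟩)
  have e₁ (n : ℤ) : (f n).range = (g n).ker := by
    refine subquotMap_range_eq_ker _ _ _ _ fun z hz => ⟨fun h => ?_, ?_⟩
    · obtain ⟨s, hs, t, ht, h⟩ := mem_relB.1 h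
      have h' : z = s + D t := h.symm
      subst h'
      have hz2 := (mem_relZ.1 hz).2
      rw [map_add, hD, add_zero] at hz2
      exact ⟨s, ⟨hs, hz2⟩, mem_relB.2 ⟨0, zero_mem _, t, ht, by simp⟩⟩
    · rintro ⟨w, hw, h⟩
      obtain ⟨s, hs, t, ht, h⟩ := mem_relB.1 h
      exact mem_relB.2 ⟨w + s, add_mem hw.1 (h₁ _ hs), t, ht, by rw [add_assoc, h]; simp⟩
  have e₂ (n n' : ℤ) (hn : n + 1 = n') : (g n).range = (d n n' hn).ker := by
    subst hn
    refine subquotMap_range_eq_ker _ _ _ _ fun z hz => ⟨fun h => ?_, ?_⟩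
    · obtain ⟨s, hs, t, ht, h⟩ := mem_relB.1 h
      rw [add_sub_cancel_right] at ht
      refine ⟨z - t, mem_relZ.2 ⟨sub_mem (mem_relZ.1 hz).1 (h₂ _ ht), ?_⟩,
        mem_relB.2 ⟨t, ht, 0, zero_mem _, by simp⟩⟩
      have : D (z - t) = s := by rw [map_sub, ← h, add_sub_cancel_right]
      rwa [this]
    · rintro ⟨w, hw, h⟩
      obtain ⟨s, hs, t, ht, h⟩ := mem_relB.1 h
      refine mem_relB.2 ⟨D w, hw.2, s, by simpa using hs, ?_⟩
      have : z = w + (s + D t) := by rw [h]; simp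
      rw [this, map_add, map_add, hD, add_zero]
  have e₃ (n n' : ℤ) (hn : n + 1 = n') : (d n n' hn).range = (f n').ker := by
    subst hn
    refine subquotMap_range_eq_ker _ _ _ _ fun z hz => ⟨fun h => ?_, ?_⟩
    · obtain ⟨s, hs, t, ht, h⟩ := mem_relB.1 h
      rw [add_sub_cancel_right] at ht
      have h' : z = s + D t := h.symm
      subst h'
      refine ⟨t, ⟨ht, ?_⟩, mem_relB.2 ⟨s, hs, 0, zero_mem _, by simp⟩⟩
      have := sub_mem (mem_relZ.1 hz).1 (h₁ _ hs)
      rwa [add_sub_cancel_left] at this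
    · rintro ⟨w, hw, h⟩
      obtain ⟨s, hs, t, ht, h⟩ := mem_relB.1 h
      rw [add_sub_cancel_right] at ht
      refine mem_relB.2 ⟨s, hs, t + w, ?_, ?_⟩
      · rw [add_sub_cancel_right]
        exact add_mem (h₂ _ ht) hw.1
      · rw [map_add, ← add_assoc, h]
        simp
  -- `c n` belongs to the connecting map leaving degree `n`; the one arriving in degree `n` is `c (n
  -- - 1)`.
  refine ⟨fun n => Nat.card (f n).range, fun n => Nat.card (g n).range,
    fun n => Nat.card (d n (n + 1) rfl).range, fun n => ⟨?_, ?_, ?_⟩⟩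
  · have h := card_eq_card_range_mul_card_range _ _ (e₃ (n - 1) n (by ring))
    rw [h]
    congr 1
    have : ∀ k (hk : n - 1 + 1 = k), Nat.card (d (n - 1) k hk).range =
        Nat.card (d (n - 1) (n - 1 + 1) rfl).range := by
      rintro k rfl
      rfl
    exact this n (by ring)
  · exact card_eq_card_range_mul_card_range _ _ (e₁ n)
  · exact card_eq_card_range_mul_card_range _ _ (e₂ n _ rfl)

end RelativeCohomology

/-! ### Truncated Euler characteristics -/

section EulerCharacteristic

/-- The alternating product of the values of `x` in the degrees `0, -1, …, -N + 1`. -/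
def altProd (N : ℕ) (x : ℤ → ℕ) : ℚ :=
  ∏ k ∈ Finset.range N, (x (-k) : ℚ) ^ ((((-k : ℤ).negOnePow : ℤˣ)) : ℤ)

lemma altProd_mul (N : ℕ) (x y : ℤ → ℕ) :
    altProd N (fun n => x n * y n) = altProd N x * altProd N y := by
  simp only [altProd, ← Finset.prod_mul_distrib]
  exact Finset.prod_congr rfl fun k _ => by rw [Nat.cast_mul, mul_zpow]

lemma altProd_congr (N : ℕ) {x y : ℤ → ℕ} (h : ∀ n ≤ 0, x n = y n) :
    altProd N x = altProd N y :=
  Finset.prod_congr rfl fun k _ => by rw [h _ (by simp)]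

/-- Each intermediate `c n` occurs in two consecutive degrees, with opposite exponents; only the two
ends survive. -/
lemma altProd_telescope (c : ℤ → ℕ) (hc : ∀ n ≤ 0, c n ≠ 0) (N : ℕ) :
    altProd N (fun n => c (n - 1) * c n) =
      c 0 * ((c (-N) : ℚ) ^ ((((-N : ℤ).negOnePow : ℤˣ)) : ℤ))⁻¹ := by
  induction N with
  | zero =>
    have := hc 0 le_rfl
    simp [altProd, this]
  | succ N ih =>
    refine (Finset.prod_range_succ _ _).trans ?_
    rw [altProd] at ih
    rw [ih]
    beta_reduce
    have h1 : (-(N : ℤ) - 1) = -((N + 1 : ℕ) : ℤ) := by push_cast; ring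
    have h2 : (c (-N) : ℚ) ^ ((((-N : ℤ).negOnePow : ℤˣ)) : ℤ) ≠ 0 :=
      zpow_ne_zero _ (by exact_mod_cast hc _ (by simp))
    rw [h1, Nat.cast_mul, mul_zpow]
    have h3 : ((-((N + 1 : ℕ) : ℤ)).negOnePow : ℤˣ) = -(-(N : ℤ)).negOnePow := by
      rw [← h1, Int.negOnePow_sub, Int.negOnePow_one]
      simp
    rw [h3, Units.val_neg, zpow_neg, inv_inv]
    field_simp

/-- Multiplicativity of the truncated alternating product in a long exact sequence, encoded by
the orders `a`, `b`, `c` of the images of the maps. -/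
lemma altProd_eq_mul_of_exact {x y z a b c : ℤ → ℕ}
    (h : ∀ n, x n = c (n - 1) * a n ∧ y n = a n * b n ∧ z n = b n * c n)
    (hz : ∀ n ≤ 0, z n ≠ 0) (hc : c 0 = 1) (N : ℕ)
    (hN : z (-N) = 1) :
    altProd N y = altProd N x * altProd N z := by
  have hc' : ∀ n ≤ 0, c n ≠ 0 := fun n hn h0 => hz n hn (by rw [(h n).2.2, h0, mul_zero])
  have hcN : c (-N) = 1 := Nat.eq_one_of_mul_eq_one_left ((h (-N)).2.2.symm.trans hN)
  have h1 := altProd_telescope c hc' N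
  rw [hc, hcN] at h1
  rw [← altProd_mul]
  have h2 : (fun n => x n * z n) = fun n => y n * (c (n - 1) * c n) := by
    funext n
    rw [(h n).1, (h n).2.1, (h n).2.2]
    ring
  rw [h2, altProd_mul, h1]
  simp

end EulerCharacteristic

/-! ### The filtered double complex and its décalage -/

section Bigraded

variable {R : Type u} [Ring R] {P : ChainComplex (ModuleCat.{u} R) ℕ}
  {A : CochainComplex (ModuleCat.{u} R) ℤ}

lemma totalD_apply (f : Bigraded P A) {p p' : ℤ} (h : p' + 1 = p) (q : ℕ) :
    totalD P A f (p, q) = f (p', q) ≫ A.d p' p +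
      ((p.negOnePow : ℤˣ) : ℤ) • (P.d q (q - 1) ≫ f (p, q - 1)) := by
  obtain rfl : p' = p - 1 := by omega
  rfl

lemma totalD_apply_succ (f : Bigraded P A) {p p' : ℤ} (h : p' + 1 = p) (q : ℕ) :
    totalD P A f (p, q + 1) = f (p', q + 1) ≫ A.d p' p +
      ((p.negOnePow : ℤˣ) : ℤ) • (P.d (q + 1) q ≫ f (p, q)) :=
  totalD_apply f h (q + 1)

lemma totalD_apply_zero (f : Bigraded P A) {p p' : ℤ} (h : p' + 1 = p) :
    totalD P A f (p, 0) = f (p', 0) ≫ A.d p' p := by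
  rw [totalD_apply f h, P.shape _ _ (by simp), zero_comp, smul_zero, add_zero]

lemma totalD_totalD (f : Bigraded P A) : totalD P A (totalD P A f) = 0 := by
  funext ⟨p, q⟩
  have h1 : p - 1 - 1 + 1 = p - 1 := by ring
  have h2 : p - 1 + 1 = p := by ring
  rw [totalD_apply _ h2, totalD_apply _ h1, totalD_apply _ h2, Int.negOnePow_sub]
  simp [Preadditive.add_comp, Preadditive.comp_add]

lemma mem_fil_antitone {p p' n : ℤ} (h : p ≤ p') {f : Bigraded P A} (hf : f ∈ fil P A p' n) :
    f ∈ fil P A p n :=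
  ⟨hf.1, fun x hx => ⟨h.trans (hf.2 x hx).1, (hf.2 x hx).2⟩⟩

lemma eq_zero_of_mem_fil {p n : ℤ} {f : Bigraded P A} (hf : f ∈ fil P A p n) {a : ℤ} {b : ℕ}
    (h : ¬(p ≤ a ∧ a + b = n)) : f (a, b) = 0 := by
  by_contra h'
  exact h (hf.2 _ h')

variable (P A) in
/-- The décalage of the filtration `Fil`, indexed by the degree in the direction of `P`. -/
def dec (q n : ℤ) : AddSubgroup (Bigraded P A) := ssZ P A 1 (n - q) n

lemma mem_dec {q n : ℤ} {f : Bigraded P A} :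
    f ∈ dec P A q n ↔ f ∈ fil P A (n - q) n ∧ totalD P A f ∈ fil P A (n - q + 1) (n + 1) :=
  Iff.rfl

lemma dec_mono {q q' : ℤ} (h : q ≤ q') (n : ℤ) : dec P A q n ≤ dec P A q' n := fun _ hf =>
  ⟨mem_fil_antitone (by omega) hf.1, mem_fil_antitone (by omega) hf.2⟩

lemma dec_eq_bot {q : ℤ} (h : q < 0) (n : ℤ) : dec P A q n = ⊥ := by
  refine eq_bot_iff.2 fun f hf => ?_
  rw [AddSubgroup.mem_bot]
  funext ⟨a, b⟩
  exact eq_zero_of_mem_fil (mem_dec.1 hf).1 (by omega)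

/-- With `relB_dec`, this is the point of the décalage: the second page of `Fil` is the cohomology
of the graded pieces of `dec`. The condition that `D f` lie in `dec (q - 1)` is just `D f ∈
Fil^{n-q+2}`, since `D (D f) = 0`. -/
lemma relZ_dec (q n : ℤ) :
    relZ (totalD P A) (dec P A (q - 1)) (dec P A q) n = ssZ P A 2 (n - q) n := by
  ext f
  rw [mem_relZ, mem_dec, mem_dec, totalD_totalD]
  constructor
  · rintro ⟨⟨h1, -⟩, h2, -⟩
    exact ⟨h1, mem_fil_antitone (by omega) h2⟩
  · rintro ⟨h1, h2⟩
    exact ⟨⟨h1, mem_fil_antitone (by omega) h2⟩, mem_fil_antitone (by omega) h2, zero_mem _⟩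

lemma relB_dec (q n : ℤ) :
    relB (totalD P A) (dec P A (q - 1)) (dec P A q) n = ssB P A 2 (n - q) n := by
  have h1 : n - (q - 1) = n - q + 1 := by ring
  have h2 : n - 1 - q = n - q - 2 + 1 := by ring
  rw [relB, ssB, dec, dec, h1, h2]
  rfl

lemma card_ssE_two (p : ℤ) (q : ℤ) :
    Nat.card (ssE P A 2 p q) =
      Nat.card (RelH (totalD P A) (dec P A (q - 1)) (dec P A q) (p + q)) := by
  rw [RelH, relZ_dec, relB_dec, add_sub_cancel_right]

/-- The family supported at a single bidegree. -/
def bisingle (p : ℤ) (q : ℕ) (g : P.X q ⟶ A.X p) : Bigraded P A :=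
  Pi.single (M := fun x : ℤ × ℕ => (P.X x.2 ⟶ A.X x.1)) (p, q) g

@[simp]
lemma bisingle_same (p : ℤ) (q : ℕ) (g : P.X q ⟶ A.X p) : bisingle p q g (p, q) = g :=
  Pi.single_eq_same _ _

lemma bisingle_of_ne {p a : ℤ} {q b : ℕ} (g : P.X q ⟶ A.X p) (h : ¬(a = p ∧ b = q)) :
    bisingle p q g (a, b) = 0 :=
  Pi.single_eq_of_ne (M := fun x : ℤ × ℕ => (P.X x.2 ⟶ A.X x.1)) (i := (p, q)) (i' := (a, b))
    (fun h' => h (Prod.ext_iff.1 h')) g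

section Bounded

variable {m : ℤ}

lemma mem_fil (hA : ∀ i : ℤ, 0 < i → IsZero (A.X i))
    (hm : ∀ i : ℤ, i < m → IsZero (A.X i)) {p n : ℤ} {f : Bigraded P A} :
    f ∈ fil P A p n ↔ ∀ (a : ℤ) (b : ℕ), ¬(p ≤ a ∧ a + b = n) → f (a, b) = 0 := by
  refine ⟨fun hf a b h => eq_zero_of_mem_fil hf h, fun hf => ?_⟩
  have h : ∀ x : ℤ × ℕ, f x ≠ 0 → p ≤ x.1 ∧ x.1 + x.2 = n := fun x hx => by
    by_contra h'
    exact hx (hf x.1 x.2 h')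
  -- In a fixed total degree the column determines the row, and only the columns in `[m, 0]` are
  -- nonzero.
  refine ⟨((Set.finite_Icc m 0).image fun a => (a, (n - a).toNat)).subset fun x hx => ?_, h⟩
  have h1 : ¬ 0 < x.1 := fun h0 => hx ((hA _ h0).eq_of_tgt _ _)
  have h2 : ¬ x.1 < m := fun h0 => hx ((hm _ h0).eq_of_tgt _ _)
  have h3 := (h x hx).2
  exact ⟨x.1, ⟨by omega, by omega⟩, Prod.ext rfl (by dsimp only; omega)⟩

lemma mem_fil_of_le (hA : ∀ i : ℤ, 0 < i → IsZero (A.X i))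
    (hm : ∀ i : ℤ, i < m → IsZero (A.X i)) {p p' n : ℤ} (h : p ≤ m) {f : Bigraded P A} (hf : f ∈ fil P A p' n) :
    f ∈ fil P A p n := by
  rw [mem_fil hA hm]
  intro a b hab
  by_cases h1 : a < m
  · exact (hm _ h1).eq_of_tgt _ _
  · exact eq_zero_of_mem_fil hf (by omega)

lemma totalD_mem_fil (hA : ∀ i : ℤ, 0 < i → IsZero (A.X i))
    (hm : ∀ i : ℤ, i < m → IsZero (A.X i)) {p n : ℤ} {f : Bigraded P A} (hf : f ∈ fil P A p n) :
    totalD P A f ∈ fil P A p (n + 1) := by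
  rw [mem_fil hA hm]
  intro a b hab
  cases b with
  | zero =>
    rw [totalD_apply_zero _ (sub_add_cancel a 1), eq_zero_of_mem_fil hf, zero_comp]
    push_cast at hab ⊢
    omega
  | succ b =>
    rw [totalD_apply_succ _ (sub_add_cancel a 1), eq_zero_of_mem_fil hf, eq_zero_of_mem_fil hf,
      zero_comp, comp_zero, smul_zero, add_zero]
    all_goals
      push_cast at hab ⊢
      omega

lemma bisingle_mem_fil (hA : ∀ i : ℤ, 0 < i → IsZero (A.X i))
    (hm : ∀ i : ℤ, i < m → IsZero (A.X i)) {p n a : ℤ} {b : ℕ} (g : P.X b ⟶ A.X a) (h : p ≤ a) (h' : a + b = n) :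
    bisingle a b g ∈ fil P A p n := by
  rw [mem_fil hA hm]
  intro a' b' hab
  refine bisingle_of_ne _ ?_
  rintro ⟨rfl, rfl⟩
  exact hab ⟨h, h'⟩

/-- In this range both filtration conditions defining `dec` concern columns `≤ m`, to the left of
which everything is zero, so `dec` is all of `K^n`. -/
lemma dec_eq_fil (hA : ∀ i : ℤ, 0 < i → IsZero (A.X i))
    (hm : ∀ i : ℤ, i < m → IsZero (A.X i)) {q n : ℤ} (h : n + 1 ≤ m + q) : dec P A q n = fil P A m n := by
  ext f
  refine ⟨fun hf => mem_fil_of_le hA hm le_rfl hf.1, fun hf => ?_⟩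
  have h1 := totalD_mem_fil hA hm hf
  exact ⟨mem_fil_antitone (by omega) hf, mem_fil_antitone (by omega) h1⟩

end Bounded

end Bigraded

/-! ### Zigzags: comparing the total complex with `H^0(A)` -/

section Zigzag

variable {R : Type u} [Ring R] {P : ChainComplex (ModuleCat.{u} R) ℕ}
  {A : CochainComplex (ModuleCat.{u} R) ℤ}

lemma exists_comp_d_eq (hac : ∀ i : ℤ, i ≠ 0 → IsZero (A.homology i)) {X : ModuleCat.{u} R}
    [Projective X] {i j k : ℤ} (hij : i + 1 = j) (hjk : j + 1 = k) (hj : j ≠ 0) (g : X ⟶ A.X j)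
    (hg : g ≫ A.d j k = 0) : ∃ h : X ⟶ A.X i, h ≫ A.d i j = g := by
  have h1 : A.ExactAt j := (A.exactAt_iff_isZero_homology j).2 (hac j hj)
  rw [A.exactAt_iff' i j k (by simp [← hij]) (by simp [← hjk])] at h1
  exact ⟨h1.liftFromProjective g hg, h1.liftFromProjective_comp g hg⟩

section Top

variable (A) (hA : ∀ i : ℤ, 0 < i → IsZero (A.X i))

/-- The projection from the last term of a complex to its last cohomology group. -/
def toTopHomology : A.X 0 ⟶ A.homology 0 :=
  A.liftCycles (𝟙 _) 1 (by simp) ((hA 1 one_pos).eq_of_tgt _ _) ≫ A.homologyπ 0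

lemma isIso_iCycles_zero (hA : ∀ i : ℤ, 0 < i → IsZero (A.X i)) : IsIso (A.iCycles 0) :=
  A.isIso_iCycles 0 1 (by simp) ((hA 1 one_pos).eq_of_tgt _ _)

lemma iCycles_toTopHomology : A.iCycles 0 ≫ toTopHomology A hA = A.homologyπ 0 := by
  have := isIso_iCycles_zero A hA
  rw [toTopHomology, ← Category.assoc]
  convert Category.id_comp _
  rw [← cancel_mono (A.iCycles 0)]
  simp

instance : Epi (toTopHomology A hA) := by
  have h : Epi (A.iCycles 0 ≫ toTopHomology A hA) := by
    rw [iCycles_toTopHomology]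
    infer_instance
  exact epi_of_epi (A.iCycles 0) _

lemma d_toTopHomology : A.d (-1) 0 ≫ toTopHomology A hA = 0 := by
  rw [← A.toCycles_i, Category.assoc, iCycles_toTopHomology, A.toCycles_comp_homologyπ]

lemma exact_toTopHomology :
    (ShortComplex.mk (A.d (-1) 0) (toTopHomology A hA) (d_toTopHomology A hA)).Exact := by
  have := isIso_iCycles_zero A hA
  have h := ShortComplex.exact_of_g_is_cokernel
    (ShortComplex.mk _ _ (A.toCycles_comp_homologyπ (-1) 0)) (A.homologyIsCokernel (-1) 0 (by simp))
  let e : ShortComplex.mk _ _ (A.toCycles_comp_homologyπ (-1) 0) ≅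
      ShortComplex.mk (A.d (-1) 0) (toTopHomology A hA) (d_toTopHomology A hA) :=
    ShortComplex.isoMk (Iso.refl _) (asIso (A.iCycles 0)) (Iso.refl _) (by simp)
      (by simp [iCycles_toTopHomology])
  exact ShortComplex.exact_of_iso e h

lemma totalD_comp_toTopHomology_zero (f : Bigraded P A) :
    totalD P A f (0, 0) ≫ toTopHomology A hA = 0 := by
  rw [totalD_apply_zero _ (neg_add_cancel 1), Category.assoc, d_toTopHomology, comp_zero]

lemma totalD_comp_toTopHomology_succ (f : Bigraded P A) (b : ℕ) :
    totalD P A f (0, b + 1) ≫ toTopHomology A hA =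
      P.d (b + 1) b ≫ f (0, b) ≫ toTopHomology A hA := by
  rw [totalD_apply_succ _ (neg_add_cancel 1), Preadditive.add_comp, Category.assoc,
    d_toTopHomology, comp_zero, zero_add, Preadditive.zsmul_comp, Category.assoc]
  simp

end Top

variable {m : ℤ} [∀ q, Projective (P.X q)]

/-- Zigzag argument, clearing one column at a time from right to left. `k` is the rightmost column
that may be nonzero, and `N` bounds the number of columns left before column `m` is passed. -/
lemma exists_totalD_eq_of_vanishing (hA : ∀ i : ℤ, 0 < i → IsZero (A.X i))
    (hm : ∀ i : ℤ, i < m → IsZero (A.X i))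
    (hac : ∀ i : ℤ, i ≠ 0 → IsZero (A.homology i)) (N : ℕ) : ∀ (k : ℤ), k ≤ 0 → k < m + N → ∀ (n : ℤ)
    (e : Bigraded P A), e ∈ fil P A m n → totalD P A e = 0 →
    (∀ (a : ℤ) (b : ℕ), k < a → e (a, b) = 0) →
    (∀ b : ℕ, ∃ h : P.X b ⟶ A.X (k - 1), h ≫ A.d (k - 1) k = e (k, b)) →
    ∃ f ∈ fil P A m (n - 1), totalD P A f = e ∧ ∀ (a : ℤ) (b : ℕ), k ≤ a → f (a, b) = 0 := by
  induction N with
  | zero =>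
    intro k _ hk n e he _ hv _
    refine ⟨0, zero_mem _, ?_, fun _ _ _ => rfl⟩
    rw [map_zero]
    funext ⟨a, b⟩
    by_cases ha : k < a
    · exact (hv a b ha).symm
    · exact (hm a (by push_cast at hk; omega)).eq_of_tgt _ _
  | succ N ih =>
    intro k hk0 hk n e he hDe hv hex
    have key : ∃ f ∈ fil P A m (n - 1), (∀ (a : ℤ) (b : ℕ), k ≤ a → f (a, b) = 0) ∧
        ∀ b : ℕ, f (k - 1, b) ≫ A.d (k - 1) k = e (k, b) := by
      -- Total degree `n` meets column `k` only in row `n - k`, so a single lift is enough, and none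
      -- is needed if that row is negative.
      by_cases hkn : k ≤ n
      · obtain ⟨b, hb⟩ := Int.eq_ofNat_of_zero_le (sub_nonneg.2 hkn)
        obtain ⟨h, hh⟩ := hex b
        refine ⟨bisingle (k - 1) b h, mem_fil_of_le hA hm le_rfl
          (bisingle_mem_fil (p := k - 1) hA hm h le_rfl (by omega)),
          fun a b' ha => bisingle_of_ne _ (by omega), fun b' => ?_⟩
        by_cases hb' : b' = b
        · subst hb'
          rw [bisingle_same, hh]
        · rw [bisingle_of_ne _ (by omega), zero_comp, eq_zero_of_mem_fil he (by omega)]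
      · exact ⟨0, zero_mem _, fun _ _ _ => rfl, fun b => by
          rw [eq_zero_of_mem_fil he (by omega), Pi.zero_apply, zero_comp]⟩
    obtain ⟨f, hf, hf0, hfd⟩ := key
    have hDf : totalD P A f ∈ fil P A m n := by
      have := totalD_mem_fil hA hm hf
      rwa [sub_add_cancel] at this
    have hv' : ∀ (a : ℤ) (b : ℕ), k - 1 < a → (e - totalD P A f) (a, b) = 0 := by
      intro a b ha
      rw [Pi.sub_apply, totalD_apply f (sub_add_cancel a 1), hf0 a _ (by omega), comp_zero,
        smul_zero, add_zero]
      obtain rfl | ha : a = k ∨ k < a := by omega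
      · rw [hfd, sub_self]
      · rw [hv a b ha, hf0 _ _ (by omega), zero_comp, sub_zero]
    have hD' : totalD P A (e - totalD P A f) = 0 := by
      rw [map_sub, hDe, totalD_totalD, sub_zero]
    -- Column `k` is now zero, so the entries of column `k - 1` are killed by `d`; they lift by
    -- exactness of `A` in degree `k - 1 ≠ 0` and projectivity.
    obtain ⟨f', hf', h1, h2⟩ := ih (k - 1) (by omega) (by push_cast at hk; omega) n
      (e - totalD P A f) (sub_mem he hDf) hD' hv' (fun b => by
        refine exists_comp_d_eq hac (sub_add_cancel _ 1) (sub_add_cancel k 1) (by omega) _ ?_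
        have := congrFun hD' (k, b)
        rwa [totalD_apply _ (sub_add_cancel k 1), hv' k _ (by omega), comp_zero, smul_zero,
          add_zero] at this)
    exact ⟨f + f', add_mem hf hf', by rw [map_add, h1, add_sub_cancel], fun a b ha => by
      rw [Pi.add_apply, hf0 a b ha, h2 a b (by omega), add_zero]⟩

/-- A form of injectivity on cohomology of `K → Hom(P, H^0(A))`. By exactness at `A^0`, being killed
by `ε` is what allows the zigzag to start in column 0. -/
lemma exists_totalD_eq (hA : ∀ i : ℤ, 0 < i → IsZero (A.X i))
    (hm : ∀ i : ℤ, i < m → IsZero (A.X i))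
    (hac : ∀ i : ℤ, i ≠ 0 → IsZero (A.homology i)) {n : ℤ} {e : Bigraded P A} (he : e ∈ fil P A m n)
    (hDe : totalD P A e = 0) (h0 : ∀ b : ℕ, e (0, b) ≫ toTopHomology A hA = 0) :
    ∃ f ∈ fil P A m (n - 1), totalD P A f = e ∧ ∀ b : ℕ, f (0, b) = 0 := by
  obtain ⟨f, hf, h1, h2⟩ := exists_totalD_eq_of_vanishing hA hm hac (1 - m).toNat 0 le_rfl (by omega)
    n e he hDe (fun a b ha => (hA a ha).eq_of_tgt _ _) (fun b =>
      ⟨(exact_toTopHomology A hA).liftFromProjective _ (h0 b),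
        (exact_toTopHomology A hA).liftFromProjective_comp _ (h0 b)⟩)
  exact ⟨f, hf, h1, fun b => h2 0 b le_rfl⟩

/-- The matching surjectivity: `D` of the family supported at `g` is a cocycle with column 0 killed
by `ε`, hence equals `D f` with `f` zero in column 0, and subtracting `f` does not disturb `g`. -/
lemma exists_cocycle_extending (hA : ∀ i : ℤ, 0 < i → IsZero (A.X i))
    (hm : ∀ i : ℤ, i < m → IsZero (A.X i))
    (hac : ∀ i : ℤ, i ≠ 0 → IsZero (A.homology i)) (n : ℕ) (g : P.X n ⟶ A.X 0)
    (hg : P.d (n + 1) n ≫ g ≫ toTopHomology A hA = 0) :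
    ∃ f ∈ fil P A m n, totalD P A f = 0 ∧ f (0, n) = g := by
  have h0 : bisingle 0 n g ∈ fil P A m (n : ℤ) := mem_fil_of_le hA hm le_rfl
    (bisingle_mem_fil (p := 0) hA hm g le_rfl (by omega))
  obtain ⟨f, hf, h1, h2⟩ := exists_totalD_eq hA hm hac (totalD_mem_fil hA hm h0)
    (totalD_totalD _) (fun b => by
      cases b with
      | zero => exact totalD_comp_toTopHomology_zero A hA _
      | succ b =>
        rw [totalD_comp_toTopHomology_succ]
        by_cases hb : b = n
        · subst hb
          rw [bisingle_same, hg]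
        · rw [bisingle_of_ne _ (by omega), zero_comp, comp_zero])
  rw [add_sub_cancel_right] at hf
  refine ⟨bisingle 0 n g - f, sub_mem h0 hf, by rw [map_sub, h1, sub_self], ?_⟩
  rw [Pi.sub_apply, bisingle_same, h2, sub_zero]

end Zigzag

/-! ### Cohomology of complexes of abelian groups, by elements -/

section Homology

variable (K : CochainComplex AddCommGrpCat.{u} ℤ)

lemma iCycles_injective (p : ℤ) : Function.Injective (K.iCycles p) :=
  (AddCommGrpCat.mono_iff_injective _).1 inferInstance

lemma homologyπ_surjective (p : ℤ) : Function.Surjective (K.homologyπ p) :=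
  (AddCommGrpCat.epi_iff_surjective _).1 inferInstance

lemma d_iCycles_apply (p j : ℤ) (z : K.cycles p) : K.d p j (K.iCycles p z) = 0 := by
  rw [← ConcreteCategory.comp_apply, K.iCycles_d]
  rfl

lemma homologyπ_eq_zero_iff {i p : ℤ} (h : i + 1 = p) (z : K.cycles p) :
    K.homologyπ p z = 0 ↔ ∃ y : K.X i, K.d i p y = K.iCycles p z := by
  have hex := ShortComplex.exact_of_g_is_cokernel
    (ShortComplex.mk _ _ (K.toCycles_comp_homologyπ i p)) (K.homologyIsCokernel i p (by simp [← h]))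
  have hy (y : K.X i) : K.iCycles p (K.toCycles i p y) = K.d i p y := by
    rw [← ConcreteCategory.comp_apply, K.toCycles_i]
  constructor
  · intro hz
    obtain ⟨y, hy'⟩ := (ShortComplex.ab_exact_iff _).1 hex z hz
    exact ⟨y, (hy y).symm.trans (congrArg (K.iCycles p) hy')⟩
  · rintro ⟨y, hy'⟩
    rw [← hy] at hy'
    rw [← iCycles_injective K p hy', ← ConcreteCategory.comp_apply, K.toCycles_comp_homologyπ]
    rfl

variable {B : Type u} [AddCommGroup B] {K}

/-- The map to the cohomology of a complex of abelian groups given by a map to the cocycles. -/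
def toHomology {p j : ℤ} (h : p + 1 = j) (W : AddSubgroup B) (φ : W →+ K.X p)
    (hφ : ∀ w, K.d p j (φ w) = 0) : W →+ K.homology p :=
  (K.liftCycles (AddCommGrpCat.ofHom φ) j (by simp [← h]) (by ext w; exact hφ w) ≫
    K.homologyπ p).hom

section

variable {i p j : ℤ} {W : AddSubgroup B}

lemma exists_toHomology (hj : p + 1 = j) (φ : W →+ K.X p)
    (hφ : ∀ w, K.d p j (φ w) = 0) (w : W) :
    ∃ z : K.cycles p, K.iCycles p z = φ w ∧ toHomology hj W φ hφ w = K.homologyπ p z := by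
  refine ⟨K.liftCycles (AddCommGrpCat.ofHom φ) j (by simp [← hj]) (by ext w; exact hφ w) w,
    ?_, rfl⟩
  rw [← ConcreteCategory.comp_apply, K.liftCycles_i]
  rfl

lemma toHomology_eq_zero_iff (hi : i + 1 = p) (hj : p + 1 = j) (φ : W →+ K.X p)
    (hφ : ∀ w, K.d p j (φ w) = 0) (w : W) :
    toHomology hj W φ hφ w = 0 ↔ ∃ y : K.X i, K.d i p y = φ w := by
  obtain ⟨z, h1, h2⟩ := exists_toHomology hj φ hφ w
  rw [h2, homologyπ_eq_zero_iff K hi, h1]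

lemma toHomology_surjective (hi : i + 1 = p) (hj : p + 1 = j) (φ : W →+ K.X p)
    (hφ : ∀ w, K.d p j (φ w) = 0)
    (h : ∀ x, K.d p j x = 0 → ∃ w, ∃ y : K.X i, x = φ w + K.d i p y) :
    Function.Surjective (toHomology hj W φ hφ) := by
  intro x
  obtain ⟨z, rfl⟩ := homologyπ_surjective K p x
  obtain ⟨w, y, hw⟩ := h _ (d_iCycles_apply K p j z)
  obtain ⟨z', h1, h2⟩ := exists_toHomology hj φ hφ w
  refine ⟨w, ?_⟩
  rw [h2, eq_comm, ← sub_eq_zero, ← map_sub, homologyπ_eq_zero_iff K hi, map_sub, hw, h1]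
  exact ⟨y, by abel⟩

lemma card_subquot_eq_card_homology (hi : i + 1 = p) (hj : p + 1 = j) (φ : W →+ K.X p)
    (hφ : ∀ w, K.d p j (φ w) = 0) {N : AddSubgroup B}
    (h : ∀ x, K.d p j x = 0 → ∃ w, ∃ y : K.X i, x = φ w + K.d i p y)
    (h' : ∀ w, (∃ y : K.X i, K.d i p y = φ w) ↔ (w : B) ∈ N) :
    Nat.card (Subquot W N) = Nat.card (K.homology p) := by
  have h1 : N.addSubgroupOf W = (toHomology hj W φ hφ).ker := by
    ext w
    rw [AddMonoidHom.mem_ker, toHomology_eq_zero_iff hi, h', AddSubgroup.mem_addSubgroupOf]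
  rw [Subquot, h1]
  exact Nat.card_congr (QuotientAddGroup.quotientKerEquivOfSurjective _
    (toHomology_surjective hi hj φ hφ h)).toEquiv

end

/-- Computation of the order of a cohomology group of a complex whose terms are identified with
given abelian groups. -/
lemma card_subquot_eq_card_homology_of_equiv {i p j : ℤ} (hi : i + 1 = p) (hj : p + 1 = j)
    {X₁ X₂ X₃ : Type*} [AddCommGroup X₁] [AddCommGroup X₂] [AddCommGroup X₃]
    (e₁ : X₁ ≃+ K.X i) (e₂ : X₂ ≃+ K.X p) (e₃ : X₃ ≃+ K.X j) (a : X₁ →+ X₂) (b : X₂ →+ X₃)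
    (ha : ∀ x, K.d i p (e₁ x) = e₂ (a x)) (hb : ∀ x, K.d p j (e₂ x) = e₃ (b x))
    {W N : AddSubgroup B} (φ : W →+ X₂) (hφ : ∀ w, b (φ w) = 0)
    (h : ∀ x, b x = 0 → ∃ w, ∃ y, x = φ w + a y)
    (h' : ∀ w, (∃ y, a y = φ w) ↔ (w : B) ∈ N) :
    Nat.card (Subquot W N) = Nat.card (K.homology p) := by
  refine card_subquot_eq_card_homology hi hj (e₂.toAddMonoidHom.comp φ) (fun w => ?_)
    (fun x hx => ?_) (fun w => ?_)
  · exact (hb _).trans (by rw [hφ, map_zero])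
  · obtain ⟨x, rfl⟩ := e₂.surjective x
    rw [hb, EmbeddingLike.map_eq_zero_iff] at hx
    obtain ⟨w, y, rfl⟩ := h x hx
    exact ⟨w, e₁ y, by rw [ha]; exact map_add e₂ _ _⟩
  · rw [← h']
    refine e₁.surjective.exists.trans (exists_congr fun y => ?_)
    rw [ha]
    exact e₂.injective.eq_iff

end Homology

section

variable {R : Type u} [Ring R] {P : ChainComplex (ModuleCat.{u} R) ℕ}
  {A : CochainComplex (ModuleCat.{u} R) ℤ}

lemma negOnePow_smul_smul {X Y : ModuleCat.{u} R} (p : ℤ) (f : X ⟶ Y) :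
    ((p.negOnePow : ℤˣ) : ℤ) • ((p.negOnePow : ℤˣ) : ℤ) • f = f := by
  rw [smul_smul, ← Units.val_mul, Int.units_mul_self, Units.val_one, one_smul]

lemma mem_fil_succ {m : ℤ} (hA : ∀ i : ℤ, 0 < i → IsZero (A.X i))
    (hm : ∀ i : ℤ, i < m → IsZero (A.X i)) {p n : ℤ} {f : Bigraded P A} (hf : f ∈ fil P A p n)
    (h : ∀ b : ℕ, p + b = n → f (p, b) = 0) : f ∈ fil P A (p + 1) n := by
  rw [mem_fil hA hm]
  intro a b hab
  by_cases h' : a = p ∧ p + b = n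
  · rw [h'.1, h b h'.2]
  · exact eq_zero_of_mem_fil hf (by omega)

/-- Column `p - 1` of `f` is zero, so column `p` of `D f` comes from the differential of `P` alone.
-/
lemma d_comp_eq_zero_of_mem_fil {p n : ℤ} {q : ℕ} {f : Bigraded P A}
    (hf : f ∈ fil P A p n) (hf' : totalD P A f ∈ fil P A (p + 1) (n + 1)) :
    P.d (q + 1) q ≫ f (p, q) = 0 := by
  have h1 : totalD P A f (p, q + 1) = 0 := eq_zero_of_mem_fil hf' (by omega)
  rw [totalD_apply_succ _ (sub_add_cancel p 1), eq_zero_of_mem_fil hf (by omega), zero_comp,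
    zero_add] at h1
  rw [← negOnePow_smul_smul p (P.d (q + 1) q ≫ f (p, q)), h1, smul_zero]

end

/-! ### The second page in terms of `Ext` -/

section Ext

variable {R : Type u} [Ring R] {M : ModuleCat.{u} R} (P : ProjectiveResolution M)
  {A : CochainComplex (ModuleCat.{u} R) ℤ}

/-- The class in `Ext^q(M, A^p)` of the leading component of an element of `Z_2^{p,q}`. -/
def ssZToExt (p : ℤ) (q : ℕ) : ssZ P.complex A 2 p (p + q) →+ Abelian.Ext M (A.X p) q where
  toFun f := P.extMk (f.1 (p, q)) (q + 1) rfl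
    (d_comp_eq_zero_of_mem_fil f.2.1 (mem_fil_antitone (by omega) f.2.2))
  map_zero' := by simp
  map_add' f g := (P.add_extMk _ _ _ _ _ _).symm

lemma extMk_eq_zero_of_eq {N : ModuleCat.{u} R} {q : ℕ} {f : P.complex.X (q + 1) ⟶ N}
    {hf : P.complex.d (q + 1 + 1) (q + 1) ≫ f = 0} (g : P.complex.X q ⟶ N)
    (h : P.complex.d (q + 1) q ≫ g = f) : P.extMk f (q + 1 + 1) rfl hf = 0 :=
  (P.extMk_eq_zero_iff _ _ _ _ q rfl).2 ⟨g, h⟩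

/-- The isomorphism sends an element of `Z_2` to the class of its leading component. The component
in the next column is a witness that `d` of this class vanishes in `Ext`. -/
theorem card_ssE_two_eq_card_cohExt {m : ℤ} (hA : ∀ i : ℤ, 0 < i → IsZero (A.X i))
    (hm : ∀ i : ℤ, i < m → IsZero (A.X i)) (p : ℤ) {q : ℕ} (hq : 0 < q) :
    Nat.card (ssE P.complex A 2 p q) = Nat.card (cohExt M A p q) := by
  obtain ⟨q, rfl⟩ := Nat.exists_eq_add_of_lt hq
  rw [zero_add]
  let d (i j : ℤ) : Abelian.Ext M (A.X i) (q + 1) →+ Abelian.Ext M (A.X j) (q + 1) :=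
    ((Abelian.extFunctorObj M (q + 1)).map (A.d i j)).hom
  have hd (i j : ℤ) (x : Abelian.Ext M (A.X i) (q + 1)) :
      d i j x = x.comp (Abelian.Ext.mk₀ (A.d i j)) (add_zero _) := rfl
  refine card_subquot_eq_card_homology_of_equiv (i := p - 1) (j := p + 1) (sub_add_cancel p 1) rfl
    (X₁ := Abelian.Ext M (A.X (p - 1)) (q + 1)) (X₂ := Abelian.Ext M (A.X p) (q + 1))
    (X₃ := Abelian.Ext M (A.X (p + 1)) (q + 1)) (AddEquiv.refl _) (AddEquiv.refl _)
    (AddEquiv.refl _) (d _ _) (d _ _) (fun _ => rfl) (fun _ => rfl) (ssZToExt P p (q + 1)) ?_ ?_ ?_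
  · rintro ⟨f, hf⟩
    rw [hd]
    have hf0 : P.complex.d (q + 1 + 1) (q + 1) ≫ f (p, q + 1) = 0 :=
      d_comp_eq_zero_of_mem_fil hf.1 (mem_fil_antitone (by omega) hf.2)
    refine (P.extMk_comp_mk₀ (f (p, q + 1)) _ rfl hf0 _).trans (extMk_eq_zero_of_eq P
      (-(((p + 1).negOnePow : ℤˣ) : ℤ) • f (p + 1, q)) ?_)
    have h1 : totalD P.complex A f (p + 1, q + 1) = 0 :=
      eq_zero_of_mem_fil hf.2 (by push_cast; omega)
    rw [totalD_apply_succ _ rfl, add_eq_zero_iff_eq_neg] at h1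
    rw [h1, Preadditive.comp_zsmul, neg_smul]
  · intro x hx
    obtain ⟨g, hg, rfl⟩ := P.extMk_surjective x (q + 1 + 1) rfl
    rw [hd, P.extMk_comp_mk₀, P.extMk_eq_zero_iff _ _ _ _ q rfl] at hx
    obtain ⟨h, hh⟩ := hx
    -- The second term, with the sign of `δ` in column `p + 1`, cancels `g ≫ d` and pushes `D f`
    -- into `Fil^{p+2}`.
    let f : Bigraded P.complex A := bisingle p (q + 1) g -
      bisingle (p + 1) q ((((p + 1).negOnePow : ℤˣ) : ℤ) • h)
    have hf : f ∈ fil P.complex A p (p + (q + 1 : ℕ)) :=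
      sub_mem (bisingle_mem_fil hA hm _ le_rfl rfl)
        (bisingle_mem_fil hA hm _ (by omega) (by push_cast; ring))
    have hfp : f (p, q + 1) = g := by
      change bisingle _ _ _ _ - bisingle _ _ _ _ = _
      rw [bisingle_same, bisingle_of_ne _ (by omega), sub_zero]
    have hf1 : totalD P.complex A f ∈ fil P.complex A (p + 1) (p + (q + 1 : ℕ) + 1) := by
      refine mem_fil_succ hA hm (totalD_mem_fil hA hm hf) fun b hb => ?_
      obtain rfl : b = q + 1 + 1 := by omega
      rw [totalD_apply_succ _ (sub_add_cancel p 1), hfp, hg, smul_zero, add_zero,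
        eq_zero_of_mem_fil hf (by omega), zero_comp]
    have hf2 : totalD P.complex A f ∈ fil P.complex A (p + 1 + 1) (p + (q + 1 : ℕ) + 1) := by
      refine mem_fil_succ hA hm hf1 fun b hb => ?_
      obtain rfl : b = q + 1 := by omega
      have : f (p + 1, q) = -((((p + 1).negOnePow : ℤˣ) : ℤ) • h) := by
        change bisingle _ _ _ _ - bisingle _ _ _ _ = _
        rw [bisingle_same, bisingle_of_ne _ (by omega), zero_sub]
      rw [totalD_apply_succ _ rfl, hfp, this, ← hh, ← Preadditive.comp_zsmul, smul_neg,
        negOnePow_smul_smul, Preadditive.comp_neg, add_neg_cancel]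
    refine ⟨⟨f, hf, ?_⟩, 0, ?_⟩
    · rw [show p + 2 = p + 1 + 1 by ring]
      exact hf2
    · rw [map_zero, add_zero]
      simp only [ssZToExt, AddMonoidHom.coe_mk, ZeroHom.coe_mk, hfp]
  · rintro ⟨f, hf⟩
    have hf0 : P.complex.d (q + 1 + 1) (q + 1) ≫ f (p, q + 1) = 0 :=
      d_comp_eq_zero_of_mem_fil hf.1 (mem_fil_antitone (by omega) hf.2)
    constructor
    · rintro ⟨y, hy⟩
      obtain ⟨g, hg, rfl⟩ := P.extMk_surjective y (q + 1 + 1) rfl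
      rw [hd, P.extMk_comp_mk₀] at hy
      have hy' := (P.sub_extMk (f (p, q + 1)) _ _ _ hf0 _).symm.trans (sub_eq_zero.2 hy.symm)
      rw [P.extMk_eq_zero_iff _ _ _ _ q rfl] at hy'
      obtain ⟨h, hh⟩ := hy'
      -- `t` is chosen so that `D t` lies in `Fil^p` with the same leading component as `f`; then `f
      -- - D t` lies in `Fil^{p+1}`.
      let t : Bigraded P.complex A := bisingle (p - 1) (q + 1) g +
        bisingle p q (((p.negOnePow : ℤˣ) : ℤ) • h)
      have ht : t ∈ fil P.complex A (p - 1) (p + (q + 1 : ℕ) - 1) :=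
        add_mem (bisingle_mem_fil hA hm _ le_rfl (by omega))
          (bisingle_mem_fil hA hm _ (by omega) (by push_cast; ring))
      have ht1 : t (p - 1, q + 1) = g := by
        change bisingle _ _ _ _ + bisingle _ _ _ _ = _
        rw [bisingle_same, bisingle_of_ne _ (by omega), add_zero]
      have ht2 : t (p, q) = ((p.negOnePow : ℤˣ) : ℤ) • h := by
        change bisingle _ _ _ _ + bisingle _ _ _ _ = _
        rw [bisingle_same, bisingle_of_ne _ (by omega), zero_add]
      have hDt : totalD P.complex A t ∈ fil P.complex A (p - 1 + 1) (p + (q + 1 : ℕ) - 1 + 1) := by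
        refine mem_fil_succ hA hm (totalD_mem_fil hA hm ht) fun b hb => ?_
        obtain rfl : b = q + 1 + 1 := by omega
        rw [totalD_apply_succ _ (sub_add_cancel (p - 1) 1), ht1, hg, smul_zero, add_zero,
          eq_zero_of_mem_fil ht (by omega), zero_comp]
      have hDtp : totalD P.complex A t (p, q + 1) = f (p, q + 1) := by
        rw [totalD_apply_succ _ (sub_add_cancel p 1), ht1, ht2, Preadditive.comp_zsmul,
          negOnePow_smul_smul, hh, add_sub_cancel]
      rw [sub_add_cancel, sub_add_cancel] at hDt
      refine AddSubgroup.mem_sup.2 ⟨f - totalD P.complex A t, ⟨?_, ?_⟩, totalD P.complex A t,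
        ⟨t, ⟨?_, ?_⟩, rfl⟩, sub_add_cancel _ _⟩
      · refine mem_fil_succ hA hm (sub_mem hf.1 hDt) fun b hb => ?_
        obtain rfl : b = q + 1 := by omega
        rw [Pi.sub_apply, hDtp, sub_self]
      · change totalD P.complex A (_ - _) ∈ fil _ _ _ _
        rw [map_sub, totalD_totalD, sub_zero,
          show p + 1 + (2 - 1) = p + 2 by ring]
        exact hf.2
      · rw [show p - 2 + 1 = p - 1 by ring]
        exact ht
      · change totalD P.complex A t ∈ fil _ _ _ _
        rw [show p - 2 + 1 + (2 - 1) = p by ring,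
          sub_add_cancel]
        exact hDt
    · intro hfB
      obtain ⟨s, hs, _, ⟨t, ht, rfl⟩, rfl⟩ := AddSubgroup.mem_sup.1 hfB
      have hs0 : s (p, q + 1) = 0 := eq_zero_of_mem_fil hs.1 (by omega)
      have ht0 : P.complex.d (q + 1 + 1) (q + 1) ≫ t (p - 1, q + 1) = 0 :=
        d_comp_eq_zero_of_mem_fil (n := p + (q + 1 : ℕ) - 1)
          (mem_fil_antitone (by omega) ht.1) (mem_fil_antitone (by omega) ht.2)
      refine ⟨P.extMk (t (p - 1, q + 1)) _ rfl ht0, ?_⟩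
      rw [hd, P.extMk_comp_mk₀, eq_comm, ← sub_eq_zero]
      refine (P.sub_extMk _ _ _ _ hf0 _).trans (extMk_eq_zero_of_eq P
        (((p.negOnePow : ℤˣ) : ℤ) • t (p, q)) ?_)
      simp only [Pi.add_apply]
      rw [hs0, zero_add, totalD_apply_succ _ (sub_add_cancel p 1), add_sub_cancel_left,
        Preadditive.comp_zsmul]

end Ext

/-- Both comparison isomorphisms are computed from one choice of left homology data, for which the
square is evident. It gives access to `annHomologyToHomology` on cocycles. -/
lemma homologyπ_mapHomologyIso_hom {C D : Type*} [Category C] [Category D] [Abelian C] [Abelian D]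
    (S : ShortComplex C) (F : C ⥤ D) [F.Additive] [F.PreservesHomology] :
    (S.map F).homologyπ ≫ (S.mapHomologyIso F).hom =
      (S.mapCyclesIso F).hom ≫ F.map S.homologyπ := by
  have h := S.homologyData.left
  have e₁ : (S.mapHomologyIso F).hom = (h.map F).homologyIso.hom ≫ F.map h.homologyIso.inv :=
    congrArg Iso.hom (h.mapHomologyIso_eq F)
  have e₂ : (S.mapCyclesIso F).hom = (h.map F).cyclesIso.hom ≫ F.map h.cyclesIso.inv :=
    congrArg Iso.hom (h.mapCyclesIso_eq F)
  have e₃ : F.map h.π ≫ F.map h.homologyIso.inv = F.map h.cyclesIso.inv ≫ F.map S.homologyπ := by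
    rw [← F.map_comp, ← F.map_comp, h.π_comp_homologyIso_inv]
  calc (S.map F).homologyπ ≫ (S.mapHomologyIso F).hom
      = ((S.map F).homologyπ ≫ (h.map F).homologyIso.hom) ≫ F.map h.homologyIso.inv :=
        (congrArg ((S.map F).homologyπ ≫ ·) e₁).trans (Category.assoc _ _ _).symm
    _ = ((h.map F).cyclesIso.hom ≫ F.map h.π) ≫ F.map h.homologyIso.inv :=
        congrArg (· ≫ F.map h.homologyIso.inv) (h.map F).homologyπ_comp_homologyIso_hom
    _ = (h.map F).cyclesIso.hom ≫ F.map h.cyclesIso.inv ≫ F.map S.homologyπ :=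
        (Category.assoc _ _ _).trans (congrArg ((h.map F).cyclesIso.hom ≫ ·) e₃)
    _ = (S.mapCyclesIso F).hom ≫ F.map S.homologyπ :=
        (Category.assoc _ _ _).symm.trans (congrArg (· ≫ F.map S.homologyπ) e₂.symm)

section

variable {R : Type u} [Ring R] (θ : Ideal R) (A : CochainComplex (ModuleCat.{u} R) ℤ)

lemma exists_annHomologyToHomology_eq (i : ℤ) (z : (annComplex θ A).cycles i) :
    ∃ w : A.cycles i,
      A.iCycles i w = ((show annihilated θ (A.X i) from (annComplex θ A).iCycles i z) : A.X i) ∧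
      annHomologyToHomology θ A i ((annComplex θ A).homologyπ i z) = A.homologyπ i w := by
  let φ := (A.sc i).mapNatTrans (annInclusion θ)
  let w := ((A.sc i).mapCyclesIso (forget₂ (ModuleCat.{u} R) AddCommGrpCat.{u})).hom (ShortComplex.cyclesMap φ z)
  refine ⟨w, ?_, ?_⟩
  · have h1 : ShortComplex.cyclesMap φ ≫ ((A.sc i).mapCyclesIso (forget₂ (ModuleCat.{u} R) AddCommGrpCat.{u})).hom ≫ (forget₂ (ModuleCat.{u} R) AddCommGrpCat.{u}).map (A.sc i).iCycles =
        ((A.sc i).map (annFunctor θ)).iCycles ≫ φ.τ₂ := by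
      exact (congrArg (ShortComplex.cyclesMap φ ≫ ·)
        (ShortComplex.mapCyclesIso_hom_iCycles _ _)).trans (ShortComplex.cyclesMap_i φ)
    exact ConcreteCategory.congr_hom h1 z
  · have h2 : ((A.sc i).map (annFunctor θ)).homologyπ ≫
        ShortComplex.homologyMap φ ≫ ((A.sc i).mapHomologyIso (forget₂ (ModuleCat.{u} R) AddCommGrpCat.{u})).hom =
        ShortComplex.cyclesMap φ ≫ ((A.sc i).mapCyclesIso (forget₂ (ModuleCat.{u} R) AddCommGrpCat.{u})).hom ≫ (forget₂ (ModuleCat.{u} R) AddCommGrpCat.{u}).map (A.sc i).homologyπ := by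
      rw [← homologyπ_mapHomologyIso_hom, ← Category.assoc, ← Category.assoc,
        ShortComplex.homologyπ_naturality]
    exact ConcreteCategory.congr_hom h2 z

variable {A} in
lemma annHomologyMap_homologyπ (hA : ∀ i : ℤ, 0 < i → IsZero (A.X i))
    (z : (annComplex θ A).cycles 0) :
    (annHomologyMap θ A 0 ((annComplex θ A).homologyπ 0 z) : A.homology 0) =
      toTopHomology A hA
        ((show annihilated θ (A.X 0) from (annComplex θ A).iCycles 0 z) : A.X 0) := by
  obtain ⟨w, h1, h2⟩ := exists_annHomologyToHomology_eq θ A 0 z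
  refine h2.trans ?_
  rw [← h1, ← iCycles_toTopHomology A hA]
  rfl

end

/-! ### Homomorphisms out of `R/θ` and elements killed by `θ` -/

section Generator

variable {R : Type u} [Ring R] {θ : Ideal R} (P : ProjectiveResolution (quotModule θ))

/-- Lifting the generator of `R/θ` to the first term of a projective resolution. -/
lemma exists_generator : ∃ x₀ : P.complex.X 0,
    (∀ t ∈ θ, ∃ w, P.complex.d 1 0 w = t • x₀) ∧
    (∀ y, ∃ (r : R) (w : _), y = r • x₀ + P.complex.d 1 0 w) ∧
    ∀ (N : ModuleCat.{u} R), ∀ x ∈ annihilated θ N,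
      ∃ g : P.complex.X 0 ⟶ N, P.complex.d 1 0 ≫ g = 0 ∧ g x₀ = x := by
  let π : P.complex.X 0 ⟶ quotModule θ := P.π.f 0
  have hπ : Function.Surjective π := (ModuleCat.epi_iff_surjective _).1
    (inferInstanceAs (Epi (P.π.f 0)))
  have hd : P.complex.d 1 0 ≫ π = 0 := P.complex_d_comp_π_f_zero
  have hex : ∀ y, π y = 0 → ∃ w, P.complex.d 1 0 w = y := fun y hy =>
    (ShortComplex.moduleCat_exact_iff _).1 P.exact₀ y hy
  obtain ⟨x₀, hx₀⟩ := hπ (Submodule.Quotient.mk (1 : R) : R ⧸ θ)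
  have hr : ∀ r : R, π (r • x₀) = (Submodule.Quotient.mk r : R ⧸ θ) := by
    intro r
    rw [map_smul, hx₀]
    change (Submodule.Quotient.mk (r • (1 : R)) : R ⧸ θ) = _
    rw [smul_eq_mul, mul_one]
  refine ⟨x₀, fun t ht => hex _ ?_, fun y => ?_, fun N x hx => ?_⟩
  · rw [hr]
    exact (Submodule.Quotient.mk_eq_zero θ).2 ht
  · obtain ⟨r, hr'⟩ := Submodule.Quotient.mk_surjective θ (show R ⧸ θ from π y)
    obtain ⟨w, hw⟩ := hex (y - r • x₀) (by rw [map_sub, hr, hr', sub_self])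
    exact ⟨r, w, by rw [hw, add_sub_cancel]⟩
  · let g : quotModule θ ⟶ N := ModuleCat.ofHom
      (Submodule.liftQ θ (LinearMap.toSpanSingleton R N x) fun t ht => hx t ht)
    refine ⟨π ≫ g, by rw [← Category.assoc, hd, zero_comp], ?_⟩
    rw [ConcreteCategory.comp_apply, hx₀]
    exact one_smul R x

/-- A lift of the generator of `R/θ` to the first term of a projective resolution. -/
def generator : P.complex.X 0 := (exists_generator P).choose

lemma apply_generator_mem {N : ModuleCat.{u} R} {g : P.complex.X 0 ⟶ N}
    (hg : P.complex.d 1 0 ≫ g = 0) : g (generator P) ∈ annihilated θ N := by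
  intro t ht
  obtain ⟨w, hw⟩ := (exists_generator P).choose_spec.1 t ht
  change t • g (exists_generator P).choose = 0
  rw [← map_smul, ← hw, ← ConcreteCategory.comp_apply, hg]
  rfl

lemma eq_zero_of_apply_generator {N : ModuleCat.{u} R} {g : P.complex.X 0 ⟶ N}
    (hg : P.complex.d 1 0 ≫ g = 0) (h : g (generator P) = 0) : g = 0 := by
  ext y
  obtain ⟨r, w, hw⟩ := (exists_generator P).choose_spec.2.1 y
  have h1 : g (P.complex.d 1 0 w) = 0 := by
    rw [← ConcreteCategory.comp_apply, hg]
    rfl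
  have h2 : g (exists_generator P).choose = 0 := h
  change g y = 0
  rw [hw, map_add, h1, add_zero, map_smul, h2, smul_zero]

lemma exists_apply_generator_eq {N : ModuleCat.{u} R} {x : N} (hx : x ∈ annihilated θ N) :
    ∃ g : P.complex.X 0 ⟶ N, P.complex.d 1 0 ≫ g = 0 ∧ g (generator P) = x :=
  (exists_generator P).choose_spec.2.2 N x hx

end Generator

lemma card_subquot_of_surjective {B X : Type*} [AddCommGroup B] [AddCommGroup X]
    {W N : AddSubgroup B} (φ : W →+ X) (h : Function.Surjective φ)
    (h' : ∀ w, φ w = 0 ↔ (w : B) ∈ N) : Nat.card (Subquot W N) = Nat.card X := by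
  have h1 : N.addSubgroupOf W = φ.ker := by
    ext w
    rw [AddMonoidHom.mem_ker, h', AddSubgroup.mem_addSubgroupOf]
  rw [Subquot, h1]
  exact Nat.card_congr (QuotientAddGroup.quotientKerEquivOfSurjective φ h).toEquiv

lemma card_subquot_eq_one {B : Type*} [AddCommGroup B] {W N : AddSubgroup B} (h : W ≤ N) :
    Nat.card (Subquot W N) = 1 := by
  rw [Subquot, AddSubgroup.addSubgroupOf_eq_top.2 h]
  exact AddSubgroup.index_top

lemma relH_congr {B : Type*} [AddCommGroup B] {D : B →+ B} {S S' T' : ℤ → AddSubgroup B} {n : ℤ}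
    (h : S' n = T' n) (h' : S' (n - 1) = T' (n - 1)) :
    Nat.card (RelH D S S' n) = Nat.card (RelH D S T' n) := by
  have h1 : relZ D S S' n = relZ D S T' n := by rw [relZ, relZ, h]
  have h2 : relB D S S' n = relB D S T' n := by rw [relB, relB, h']
  rw [RelH, h1, h2]

/-! ### The bottom step of the décalage -/

section BottomRow

variable {R : Type u} [Ring R] {P : ChainComplex (ModuleCat.{u} R) ℕ}
  {A : CochainComplex (ModuleCat.{u} R) ℤ}

lemma totalD_bisingle_zero {n : ℤ} {g : P.X 0 ⟶ A.X n} (hg : P.d 1 0 ≫ g = 0) :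
    totalD P A (bisingle n 0 g) = bisingle (n + 1) 0 (g ≫ A.d n (n + 1)) := by
  funext ⟨a, b⟩
  cases b with
  | zero =>
    by_cases h : a = n + 1
    · subst h
      rw [totalD_apply_zero _ rfl, bisingle_same, bisingle_same]
    · rw [totalD_apply_zero _ (sub_add_cancel a 1), bisingle_of_ne g (by omega),
        bisingle_of_ne (g ≫ _) (by omega), zero_comp]
  | succ b =>
    rw [totalD_apply_succ _ (sub_add_cancel a 1), bisingle_of_ne g (by omega), zero_comp, zero_add,
      bisingle_of_ne (g ≫ _) (by omega)]
    by_cases h : a = n ∧ b = 0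
    · obtain ⟨rfl, rfl⟩ := h
      rw [bisingle_same, zero_add, hg, smul_zero]
    · rw [bisingle_of_ne _ h, comp_zero, smul_zero]

/-- Rows are nonnegative, so `(n, 0)` is the only bidegree of total degree `n` in a column `≥ n`. -/
lemma eq_bisingle_of_mem_dec_zero {n : ℤ} {f : Bigraded P A} (hf : f ∈ dec P A 0 n) :
    f = bisingle n 0 (f (n, 0)) := by
  funext ⟨a, b⟩
  by_cases h : a = n ∧ b = 0
  · obtain ⟨rfl, rfl⟩ := h
    rw [bisingle_same]
  · rw [bisingle_of_ne _ h, eq_zero_of_mem_fil (mem_dec.1 hf).1 (by omega)]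

lemma d_comp_eq_zero_of_mem_dec_zero {n : ℤ} {f : Bigraded P A} (hf : f ∈ dec P A 0 n) :
    P.d 1 0 ≫ f (n, 0) = 0 := by
  rw [mem_dec, sub_zero] at hf
  exact d_comp_eq_zero_of_mem_fil hf.1 hf.2

lemma dec_zero_eq_bot (hA : ∀ i : ℤ, 0 < i → IsZero (A.X i)) {n : ℤ} (hn : 0 < n) :
    dec P A 0 n = ⊥ := by
  refine eq_bot_iff.2 fun f hf => ?_
  rw [AddSubgroup.mem_bot, eq_bisingle_of_mem_dec_zero hf, (hA n hn).eq_of_tgt (f (n, 0)) 0]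
  exact Pi.single_zero _

variable {m : ℤ}

lemma bisingle_mem_dec_zero (hA : ∀ i : ℤ, 0 < i → IsZero (A.X i))
    (hm : ∀ i : ℤ, i < m → IsZero (A.X i)) {n : ℤ} {g : P.X 0 ⟶ A.X n} (hg : P.d 1 0 ≫ g = 0) :
    bisingle n 0 g ∈ dec P A 0 n := by
  refine mem_dec.2 ⟨bisingle_mem_fil hA hm _ (by omega) (by simp), ?_⟩
  rw [totalD_bisingle_zero hg]
  exact bisingle_mem_fil hA hm _ (by omega) (by simp)

end BottomRow

/-! ### Cohomology of `A^θ` and of the total complex -/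

section Annihilated

variable {R : Type u} [Ring R] {θ : Ideal R} (P : ProjectiveResolution (quotModule θ))
  {A : CochainComplex (ModuleCat.{u} R) ℤ} {m : ℤ}

/-- Evaluation at the generator of the component in the bottom row. -/
def evalGenerator (W : AddSubgroup (Bigraded P.complex A)) (n : ℤ)
    (hW : ∀ f ∈ W, P.complex.d 1 0 ≫ f (n, 0) = 0) : W →+ annihilated θ (A.X n) where
  toFun f := ⟨f.1 (n, 0) (generator P), apply_generator_mem P (hW f f.2)⟩
  map_zero' := rfl
  map_add' _ _ := rfl

lemma apply_generator_injective {N : ModuleCat.{u} R} {g g' : P.complex.X 0 ⟶ N}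
    (hg : P.complex.d 1 0 ≫ g = 0) (hg' : P.complex.d 1 0 ≫ g' = 0)
    (h : g (generator P) = g' (generator P)) : g = g' := by
  rw [← sub_eq_zero]
  refine eq_zero_of_apply_generator P (by rw [Preadditive.comp_sub, hg, hg', sub_zero]) ?_
  exact sub_eq_zero.2 h

/-- As `dec (-1) = 0`, this is the absolute cohomology of `dec 0`. An element of `dec 0` is a map
`P_0 → A^n` factoring through `R/θ`, determined by its value at the generator, an element of
`(A^n)^θ`. -/
lemma card_relH_dec_zero (hA : ∀ i : ℤ, 0 < i → IsZero (A.X i))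
    (hm : ∀ i : ℤ, i < m → IsZero (A.X i)) (n : ℤ) :
    Nat.card (RelH (totalD P.complex A) (dec P.complex A (-1)) (dec P.complex A 0) n) =
      Nat.card ((annComplex θ A).homology n) := by
  have hbot (k : ℤ) : dec P.complex A (-1) k = ⊥ := dec_eq_bot (by omega) k
  let W := relZ (totalD P.complex A) (dec P.complex A (-1)) (dec P.complex A 0) n
  have hW : ∀ f ∈ W, P.complex.d 1 0 ≫ f (n, 0) = 0 := fun f hf =>
    d_comp_eq_zero_of_mem_dec_zero hf.1
  have hWD : ∀ f ∈ W, totalD P.complex A f = 0 := fun f hf => by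
    have := hf.2
    rw [hbot] at this
    exact this
  let d (i j : ℤ) : annihilated θ (A.X i) →+ annihilated θ (A.X j) :=
    annihilatedMap θ (A.d i j).hom
  refine card_subquot_eq_card_homology_of_equiv (i := n - 1) (j := n + 1) (sub_add_cancel n 1) rfl
    (X₁ := annihilated θ (A.X (n - 1))) (X₂ := annihilated θ (A.X n))
    (X₃ := annihilated θ (A.X (n + 1))) (AddEquiv.refl _) (AddEquiv.refl _)
    (AddEquiv.refl _) (d _ _) (d _ _) (fun _ => rfl) (fun _ => rfl) (evalGenerator P W n hW)
    ?_ ?_ ?_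
  · rintro ⟨f, hf⟩
    have h1 := congrFun (hWD f hf) (n + 1, 0)
    rw [totalD_apply_zero _ rfl] at h1
    exact Subtype.ext (ConcreteCategory.congr_hom h1 (generator P))
  · rintro ⟨x, hx⟩ hdx
    obtain ⟨g, hg, rfl⟩ := exists_apply_generator_eq P hx
    have hgd : g ≫ A.d n (n + 1) = 0 := eq_zero_of_apply_generator P
      (by rw [← Category.assoc, hg, zero_comp]) (congrArg Subtype.val hdx)
    refine ⟨⟨bisingle n 0 g, bisingle_mem_dec_zero hA hm hg, ?_⟩, 0, ?_⟩
    · change totalD P.complex A _ ∈ dec _ _ _ _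
      have h0 : (bisingle (n + 1) 0 0 : Bigraded P.complex A) = 0 := Pi.single_zero _
      rw [totalD_bisingle_zero hg, hgd, h0]
      exact zero_mem _
    · rw [map_zero, add_zero]
      refine Subtype.ext ?_
      change _ = bisingle n 0 g (n, 0) (generator P)
      rw [bisingle_same]
  · rintro ⟨f, hf⟩
    change _ ↔ f ∈ _
    rw [mem_relB]
    constructor
    · rintro ⟨⟨y, hy⟩, hyf⟩
      obtain ⟨g, hg, rfl⟩ := exists_apply_generator_eq P hy
      have h1 : g ≫ A.d (n - 1) n = f (n, 0) := apply_generator_injective P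
        (by rw [← Category.assoc, hg, zero_comp]) (hW f hf) (congrArg Subtype.val hyf)
      refine ⟨0, zero_mem _, bisingle (n - 1) 0 g, bisingle_mem_dec_zero hA hm hg, ?_⟩
      rw [zero_add, eq_bisingle_of_mem_dec_zero hf.1, totalD_bisingle_zero hg]
      have : ∀ k (hk : k = n), (bisingle k 0 (g ≫ A.d (n - 1) k) : Bigraded P.complex A) =
          bisingle n 0 (f (n, 0)) := by
        rintro k rfl
        rw [h1]
      exact this _ (sub_add_cancel n 1)
    · rintro ⟨s, hs, t, ht, h1⟩
      rw [hbot, AddSubgroup.mem_bot] at hs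
      rw [hs, zero_add] at h1
      refine ⟨⟨t (n - 1, 0) (generator P),
        apply_generator_mem P (d_comp_eq_zero_of_mem_dec_zero ht)⟩, Subtype.ext ?_⟩
      change (t (n - 1, 0) ≫ A.d (n - 1) n) (generator P) = f (n, 0) (generator P)
      rw [← h1, totalD_apply_zero _ (sub_add_cancel n 1)]

/-- In negative total degree nothing lies in column 0, so every cocycle satisfies the criterion of
`exists_totalD_eq`. -/
lemma card_relH_fil_of_neg (hA : ∀ i : ℤ, 0 < i → IsZero (A.X i))
    (hm : ∀ i : ℤ, i < m → IsZero (A.X i)) (hac : ∀ i : ℤ, i ≠ 0 → IsZero (A.homology i))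
    {n : ℤ} (hn : n < 0) :
    Nat.card (RelH (totalD P.complex A) (dec P.complex A (-1)) (fil P.complex A m) n) = 1 := by
  refine card_subquot_eq_one fun f hf => ?_
  have h1 := hf.2
  rw [AddSubgroup.coe_toAddSubmonoid, AddSubgroup.coe_comap, Set.mem_preimage,
    dec_eq_bot (by omega)] at h1
  obtain ⟨t, ht, h2, -⟩ := exists_totalD_eq hA hm hac hf.1 h1 fun b => by
    rw [eq_zero_of_mem_fil hf.1 (by omega), zero_comp]
  exact mem_relB.2 ⟨0, zero_mem _, t, ht, by rw [h2, zero_add]⟩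

/-- Composing the entry at `(0, 1)` with `ε` turns a total cocycle into a 1-cocycle of `Hom(P,
H^0(A))`. -/
lemma card_relH_fil_one (hA : ∀ i : ℤ, 0 < i → IsZero (A.X i))
    (hm : ∀ i : ℤ, i < m → IsZero (A.X i)) (hac : ∀ i : ℤ, i ≠ 0 → IsZero (A.homology i)) :
    Nat.card (RelH (totalD P.complex A) (dec P.complex A (-1)) (fil P.complex A m) 1) =
      Nat.card (Abelian.Ext (quotModule θ) (A.homology 0) 1) := by
  let ε := toTopHomology A hA
  let W := relZ (totalD P.complex A) (dec P.complex A (-1)) (fil P.complex A m) 1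
  have hD : ∀ f ∈ W, totalD P.complex A f = 0 := fun f hf => by
    have := hf.2
    rw [dec_eq_bot (by omega)] at this
    exact this
  have hW : ∀ f ∈ W, P.complex.d 2 1 ≫ f (0, 1) ≫ ε = 0 := fun f hf => by
    rw [← totalD_comp_toTopHomology_succ, hD f hf]
    exact zero_comp
  let φ : W →+ Abelian.Ext (quotModule θ) (A.homology 0) 1 :=
    { toFun := fun f => P.extMk (f.1 (0, 1) ≫ ε) 2 rfl (hW f f.2)
      map_zero' := by simp
      map_add' := fun f g => by
        refine Eq.trans ?_ (P.add_extMk _ _ _ _ (hW f f.2) (hW g g.2)).symm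
        congr 1
        exact Preadditive.add_comp _ _ _ _ _ _ }
  refine card_subquot_of_surjective φ (fun x => ?_) ?_
  · obtain ⟨g, hg, rfl⟩ := P.extMk_surjective x 2 rfl
    have hf : Projective.factorThru g ε ≫ ε = g := Projective.factorThru_comp _ _
    obtain ⟨f, hf1, hf2, hf3⟩ := exists_cocycle_extending hA hm hac 1 (Projective.factorThru g ε)
      (by rw [hf, hg])
    have hfW : f ∈ W := ⟨hf1, by
      change totalD P.complex A f ∈ dec _ _ _ _
      rw [hf2]
      exact zero_mem _⟩
    refine ⟨⟨f, hfW⟩, ?_⟩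
    change P.extMk (f (0, 1) ≫ ε) 2 rfl (hW f hfW) = _
    congr 1
    rw [hf3, hf]
  · rintro ⟨f, hf⟩
    refine (P.extMk_eq_zero_iff (f (0, 1) ≫ ε) 2 rfl (hW f hf) 0 rfl).trans ?_
    change _ ↔ f ∈ _
    rw [mem_relB]
    constructor
    · rintro ⟨g, hg⟩
      have hg' : Projective.factorThru g ε ≫ ε = g := Projective.factorThru_comp _ _
      -- `s` lifts the primitive `g` of the 1-cocycle, so column 0 of `f - D s` is killed by `ε`.
      let s : Bigraded P.complex A := bisingle 0 0 (Projective.factorThru g ε)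
      have hs : s ∈ fil P.complex A m 0 := mem_fil_of_le hA hm le_rfl
        (bisingle_mem_fil (p := 0) hA hm _ le_rfl (by simp))
      have hs1 : s (0, 0) ≫ ε = g := (congrArg (· ≫ ε) (bisingle_same _ _ _)).trans hg'
      obtain ⟨t, ht, h1, -⟩ := exists_totalD_eq hA hm hac
        (sub_mem hf.1 (totalD_mem_fil hA hm hs)) (by rw [map_sub, hD f hf, totalD_totalD, sub_zero])
        (fun b => by
          by_cases hb : b = 1
          · subst hb
            rw [Pi.sub_apply, Preadditive.sub_comp]
            refine sub_eq_zero.2 (Eq.trans hg.symm ?_)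
            rw [← hs1]
            exact (totalD_comp_toTopHomology_succ A hA s 0).symm
          · rw [eq_zero_of_mem_fil (sub_mem hf.1 (totalD_mem_fil hA hm hs)) (by omega), zero_comp])
      exact ⟨0, zero_mem _, s + t, add_mem hs ht, by rw [map_add, h1]; simp⟩
    · rintro ⟨s, hs, t, -, h1⟩
      rw [dec_eq_bot (by omega), AddSubgroup.mem_bot] at hs
      rw [hs, zero_add] at h1
      refine ⟨t (0, 0) ≫ ε, ?_⟩
      rw [← totalD_comp_toTopHomology_succ, h1]

end Annihilated

/-! ### The total complex modulo `A^θ` in degrees 0 and -1 -/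

section DegreeZero

variable {R : Type u} [Ring R] {θ : Ideal R} (P : ProjectiveResolution (quotModule θ))
  {A : CochainComplex (ModuleCat.{u} R) ℤ} {m : ℤ}

lemma annComplex_d_zero_one (hA : ∀ i : ℤ, 0 < i → IsZero (A.X i)) :
    (annComplex θ A).d 0 1 = 0 := by
  have h0 : A.d 0 1 = 0 := (hA 1 one_pos).eq_of_tgt _ _
  change (annFunctor θ).map (A.d 0 1) = 0
  rw [h0, Functor.map_zero]

lemma exists_iCycles_eq (hA : ∀ i : ℤ, 0 < i → IsZero (A.X i))
    (x : annihilated θ (A.X 0)) :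
    ∃ z : (annComplex θ A).cycles 0, (annComplex θ A).iCycles 0 z = x := by
  let K := annComplex θ A
  let φ : AddCommGrpCat.of (annihilated θ (A.X 0)) ⟶ K.X 0 := 𝟙 _
  have h0 : φ ≫ K.d 0 1 = 0 := by
    rw [annComplex_d_zero_one hA, comp_zero]
  refine ⟨K.liftCycles φ 1 (by simp) h0 x, ?_⟩
  exact ConcreteCategory.congr_hom (K.liftCycles_i φ 1 (by simp) h0) x

lemma mem_range_annHomologyMap_iff (hA : ∀ i : ℤ, 0 < i → IsZero (A.X i))
    (y : annihilated θ (A.homology 0)) :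
    y ∈ (annHomologyMap θ A 0).range ↔
      ∃ x ∈ annihilated θ (A.X 0), toTopHomology A hA x = y := by
  constructor
  · rintro ⟨h, rfl⟩
    obtain ⟨z, rfl⟩ := homologyπ_surjective _ 0 h
    exact ⟨_, Subtype.prop _, (annHomologyMap_homologyπ θ hA z).symm⟩
  · rintro ⟨x, hx, hxy⟩
    obtain ⟨z, hz⟩ := exists_iCycles_eq hA ⟨x, hx⟩
    refine ⟨(annComplex θ A).homologyπ 0 z, Subtype.ext ?_⟩
    rw [annHomologyMap_homologyπ θ hA, hz]
    exact hxy

lemma dec_comp_toTopHomology (hA : ∀ i : ℤ, 0 < i → IsZero (A.X i)) {f : Bigraded P.complex A}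
    (hf : totalD P.complex A f = 0) : P.complex.d 1 0 ≫ f (0, 0) ≫ toTopHomology A hA = 0 := by
  rw [← totalD_comp_toTopHomology_succ, hf]
  exact zero_comp

lemma totalD_bisingle_zero_zero (hA : ∀ i : ℤ, 0 < i → IsZero (A.X i)) {g : P.complex.X 0 ⟶ A.X 0}
    (hg : P.complex.d 1 0 ≫ g = 0) : totalD P.complex A (bisingle 0 0 g) = 0 := by
  rw [totalD_bisingle_zero hg, (hA (0 + 1) (by omega)).eq_of_tgt (g ≫ A.d 0 (0 + 1)) 0]
  exact Pi.single_zero _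

/-- Since `dec 0` vanishes in degree 1, relative 0-cocycles are true cocycles and represent
`H^0(A)^θ` through `ε` and the generator. Dividing by `dec 0` divides by the image of `(A^0)^θ`. -/
theorem card_indexCoker (hA : ∀ i : ℤ, 0 < i → IsZero (A.X i))
    (hm : ∀ i : ℤ, i < m → IsZero (A.X i)) (hac : ∀ i : ℤ, i ≠ 0 → IsZero (A.homology i)) :
    Nat.card (RelH (totalD P.complex A) (dec P.complex A 0) (fil P.complex A m) 0) =
      Nat.card (indexCoker θ A) := by
  let ε := toTopHomology A hA
  let W := relZ (totalD P.complex A) (dec P.complex A 0) (fil P.complex A m) 0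
  have hD : ∀ f ∈ W, totalD P.complex A f = 0 := fun f hf => by
    have := hf.2
    rw [dec_zero_eq_bot hA (by omega)] at this
    exact this
  have hW : ∀ f ∈ W, P.complex.d 1 0 ≫ f (0, 0) ≫ ε = 0 := fun f hf =>
    dec_comp_toTopHomology P hA (hD f hf)
  let φ : W →+ annihilated θ (A.homology 0) :=
    { toFun := fun f => ⟨(f.1 (0, 0) ≫ ε) (generator P), apply_generator_mem P (hW f f.2)⟩
      map_zero' := Subtype.ext (map_zero ε.hom)
      map_add' := fun f g => Subtype.ext (map_add ε.hom _ _) }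
  refine card_subquot_of_surjective ((QuotientAddGroup.mk' _).comp φ) (fun x => ?_) ?_
  · obtain ⟨⟨x, hx⟩, rfl⟩ := QuotientAddGroup.mk'_surjective _ x
    obtain ⟨g, hg, rfl⟩ := exists_apply_generator_eq P hx
    have hg' : Projective.factorThru g ε ≫ ε = g := Projective.factorThru_comp _ _
    obtain ⟨f, hf1, hf2, hf3⟩ := exists_cocycle_extending hA hm hac 0 (Projective.factorThru g ε)
      (by rw [hg', hg])
    have hfW : f ∈ W := ⟨hf1, by
      change totalD P.complex A f ∈ dec _ _ _ _
      rw [hf2]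
      exact zero_mem _⟩
    refine ⟨⟨f, hfW⟩, congrArg (QuotientAddGroup.mk' _) (Subtype.ext ?_)⟩
    change (f (0, 0) ≫ ε) (generator P) = _
    rw [hf3, hg']
  · rintro ⟨f, hf⟩
    rw [AddMonoidHom.comp_apply, QuotientAddGroup.mk'_apply, QuotientAddGroup.eq_zero_iff,
      mem_range_annHomologyMap_iff hA]
    change _ ↔ f ∈ _
    rw [mem_relB]
    constructor
    · rintro ⟨x, hx, hxf⟩
      obtain ⟨g, hg, rfl⟩ := exists_apply_generator_eq P hx
      have hs := bisingle_mem_dec_zero hA hm hg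
      have hDs := totalD_bisingle_zero_zero P hA hg
      have hs' : bisingle 0 0 g ∈ fil P.complex A m 0 := mem_fil_of_le hA hm le_rfl hs.1
      have h1 : g ≫ ε = f (0, 0) ≫ ε := apply_generator_injective P
        (by rw [← Category.assoc, hg, zero_comp]) (hW f hf) hxf
      obtain ⟨t, ht, h2, -⟩ := exists_totalD_eq hA hm hac (sub_mem hf.1 hs')
        (by rw [map_sub, hD f hf, hDs, sub_zero]) (fun b => by
          by_cases hb : b = 0
          · subst hb
            rw [Pi.sub_apply, Preadditive.sub_comp, bisingle_same]
            exact sub_eq_zero.2 h1.symm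
          · rw [eq_zero_of_mem_fil (sub_mem hf.1 hs') (by omega), zero_comp])
      exact ⟨_, hs, t, ht, by rw [h2, add_sub_cancel]⟩
    · rintro ⟨s, hs, t, -, rfl⟩
      refine ⟨_, apply_generator_mem P (d_comp_eq_zero_of_mem_dec_zero hs), ?_⟩
      have h1 : s (0, 0) ≫ ε = (s + totalD P.complex A t) (0, 0) ≫ ε := by
        rw [Pi.add_apply, Preadditive.add_comp]
        refine Eq.trans (add_zero _).symm (congrArg _ ?_)
        exact (totalD_comp_toTopHomology_zero A hA t).symm
      exact ConcreteCategory.congr_hom h1 (generator P)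

/-- The connecting map, with values in the cohomology of the annihilated complex. -/
theorem card_ker_annHomologyMap (hA : ∀ i : ℤ, 0 < i → IsZero (A.X i))
    (hm : ∀ i : ℤ, i < m → IsZero (A.X i)) (hac : ∀ i : ℤ, i ≠ 0 → IsZero (A.homology i)) :
    Nat.card (RelH (totalD P.complex A) (dec P.complex A 0) (fil P.complex A m) (-1)) =
      Nat.card (annHomologyMap θ A 0).ker := by
  let ε := toTopHomology A hA
  let W := relZ (totalD P.complex A) (dec P.complex A 0) (fil P.complex A m) (-1)
  have hD : ∀ f ∈ W, totalD P.complex A f ∈ dec P.complex A 0 0 := fun f hf => hf.2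
  let φ : W →+ annihilated θ (A.X 0) :=
    (evalGenerator P (dec P.complex A 0 0) 0 fun f hf => d_comp_eq_zero_of_mem_dec_zero hf).comp
      (((totalD P.complex A).comp W.subtype).codRestrict _ fun f => hD f f.2)
  have hφ : ∀ w, (annComplex θ A).d 0 1 (φ w) = 0 := fun w => by
    rw [annComplex_d_zero_one hA]
    rfl
  let ψ : W →+ (annComplex θ A).homology 0 :=
    toHomology (K := annComplex θ A) (j := 1) (p := 0) rfl W φ hφ
  have hψ : ∀ w, ∃ z : (annComplex θ A).cycles 0, (annComplex θ A).iCycles 0 z = φ w ∧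
      ψ w = (annComplex θ A).homologyπ 0 z := fun w =>
    exists_toHomology (K := annComplex θ A) (j := 1) rfl φ hφ w
  have hψ0 : ∀ w, ψ w ∈ (annHomologyMap θ A 0).ker := fun w => by
    obtain ⟨z, h1, h2⟩ := hψ w
    rw [AddMonoidHom.mem_ker, h2]
    refine Subtype.ext ((annHomologyMap_homologyπ θ hA z).trans ?_)
    rw [h1]
    exact ConcreteCategory.congr_hom (totalD_comp_toTopHomology_zero A hA (w : Bigraded P.complex A))
      (generator P)
  refine card_subquot_of_surjective (ψ.codRestrict _ hψ0) ?_ ?_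
  · rintro ⟨x, hx⟩
    obtain ⟨z, rfl⟩ := homologyπ_surjective _ 0 x
    have hz := (annHomologyMap_homologyπ θ hA z).symm.trans (congrArg Subtype.val hx)
    obtain ⟨⟨y, hy⟩, hyz⟩ : ∃ y : annihilated θ (A.X 0), (annComplex θ A).iCycles 0 z = y :=
      ⟨_, rfl⟩
    rw [hyz] at hz
    obtain ⟨g, hg, rfl⟩ := exists_apply_generator_eq P hy
    have hs := bisingle_mem_dec_zero hA hm hg
    have hs' : bisingle 0 0 g ∈ fil P.complex A m 0 := mem_fil_of_le hA hm le_rfl hs.1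
    have h1 : g ≫ ε = 0 := eq_zero_of_apply_generator P
      (by rw [← Category.assoc, hg, zero_comp]) hz
    -- An element of the kernel becomes a coboundary `D t` in the total complex; `t` represents its
    -- preimage under the connecting map.
    obtain ⟨t, ht, h2, -⟩ := exists_totalD_eq hA hm hac hs' (totalD_bisingle_zero_zero P hA hg)
      (fun b => by
        by_cases hb : b = 0
        · subst hb
          rw [bisingle_same]
          exact h1
        · rw [eq_zero_of_mem_fil hs' (by omega), zero_comp])
    have htW : t ∈ W := ⟨ht, by
      change totalD P.complex A t ∈ dec P.complex A 0 0
      rw [h2]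
      exact hs⟩
    refine ⟨⟨t, htW⟩, Subtype.ext ?_⟩
    obtain ⟨z', h3, h4⟩ := hψ ⟨t, htW⟩
    refine h4.trans (congrArg _ (iCycles_injective _ 0 ?_))
    rw [h3, hyz]
    refine Subtype.ext ?_
    change totalD P.complex A t (0, 0) (generator P) = _
    rw [h2, bisingle_same]
  · rintro ⟨f, hf⟩
    have hker : (ψ.codRestrict _ hψ0) ⟨f, hf⟩ = 0 ↔ ψ ⟨f, hf⟩ = 0 := Subtype.ext_iff
    rw [hker]
    refine (toHomology_eq_zero_iff (K := annComplex θ A) (i := -1) (p := 0) (j := 1)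
      (neg_add_cancel 1) rfl φ hφ ⟨f, hf⟩).trans ?_
    change _ ↔ f ∈ _
    rw [mem_relB]
    constructor
    · rintro ⟨⟨y, hy⟩, hyf⟩
      obtain ⟨g, hg, rfl⟩ := exists_apply_generator_eq P hy
      have hs := bisingle_mem_dec_zero hA hm hg
      have hs' : bisingle (-1) 0 g ∈ fil P.complex A m (-1) := mem_fil_of_le hA hm le_rfl hs.1
      have h1 : g ≫ A.d (-1) 0 = totalD P.complex A f (0, 0) := apply_generator_injective P
        (by rw [← Category.assoc, hg, zero_comp])
        (d_comp_eq_zero_of_mem_dec_zero (hD f hf)) (congrArg Subtype.val hyf)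
      have h2 : totalD P.complex A (f - bisingle (-1) 0 g) = 0 := by
        rw [map_sub, totalD_bisingle_zero hg, eq_bisingle_of_mem_dec_zero (hD f hf), ← h1]
        exact sub_self _
      obtain ⟨t, ht, h3, -⟩ := exists_totalD_eq hA hm hac (sub_mem hf.1 hs') h2 fun b => by
        rw [eq_zero_of_mem_fil (sub_mem hf.1 hs') (by omega), zero_comp]
      exact ⟨_, hs, t, ht, by rw [h3, add_sub_cancel]⟩
    · rintro ⟨s, hs, t, -, h1⟩
      have h2 := d_comp_eq_zero_of_mem_dec_zero hs
      refine ⟨(⟨s (-1, 0) (generator P), apply_generator_mem P h2⟩ : annihilated θ (A.X (-1))),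
        Subtype.ext ?_⟩
      change (s (-1, 0) ≫ A.d (-1) 0) (generator P) = totalD P.complex A f (0, 0) (generator P)
      rw [← h1, map_add, totalD_totalD, add_zero, totalD_apply_zero s (neg_add_cancel 1)]

end DegreeZero

/-! ### Multiplicativity along the filtration, and reindexing of products -/

section Numerical

/-- If the orders in degree `1` are multiplicative along a filtration, then so are the alternating
products of the orders in nonpositive degrees. -/
lemma altProd_filtration {X E : ℕ → ℤ → ℕ} (hX : ∀ n, X 0 n = 1)
    (h : ∀ q, ∃ a b c : ℤ → ℕ, ∀ n,
      X q n = c (n - 1) * a n ∧ X (q + 1) n = a n * b n ∧ E q n = b n * c n)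
    (hE : ∀ q, ∀ n ≤ 1, E q n ≠ 0) {N : ℕ} (hN : ∀ q, E q (-N) = 1) (Q : ℕ)
    (hQ : X Q 1 = ∏ q ∈ Finset.range Q, E q 1) :
    altProd N (X Q) = ∏ q ∈ Finset.range Q, altProd N (E q) := by
  have hc : ∀ q, ∃ k ≠ 0, X q 1 * E q 1 = k * X (q + 1) 1 := fun q => by
    obtain ⟨a, b, c, habc⟩ := h q
    have h0 : c 0 ≠ 0 := fun h0 => hE q 0 zero_le_one (by rw [(habc 0).2.2, h0, mul_zero])
    have h1 : c 1 ≠ 0 := fun h1 => hE q 1 le_rfl (by rw [(habc 1).2.2, h1, mul_zero])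
    refine ⟨c 0 * c 1, mul_ne_zero h0 h1, ?_⟩
    rw [(habc 1).1, (habc 1).2.1, (habc 1).2.2, sub_self]
    ring
  have hle : ∀ q, X (q + 1) 1 ≤ X q 1 * E q 1 := fun q => by
    obtain ⟨k, hk, h1⟩ := hc q
    rw [h1]
    exact Nat.le_mul_of_pos_left _ (Nat.pos_of_ne_zero hk)
  have hbound : ∀ q, X q 1 ≤ ∏ i ∈ Finset.range q, E i 1 := fun q => by
    induction q with
    | zero => simp [hX]
    | succ q ih =>
      rw [Finset.prod_range_succ]
      exact (hle q).trans (Nat.mul_le_mul_right _ ih)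
  induction Q with
  | zero => simp [altProd, hX]
  | succ Q ih =>
    rw [Finset.prod_range_succ] at hQ ⊢
    -- Equality in degree 1 descends to the previous step: the factor `E Q 1` can be cancelled from
    -- the chain of inequalities.
    have hQ' : X Q 1 = ∏ q ∈ Finset.range Q, E q 1 := by
      refine le_antisymm (hbound Q) ?_
      refine Nat.le_of_mul_le_mul_right (c := E Q 1) ?_ (Nat.pos_of_ne_zero (hE Q 1 le_rfl))
      rw [← hQ]
      exact hle Q
    rw [← ih hQ']
    obtain ⟨a, b, c, habc⟩ := h Q
    refine altProd_eq_mul_of_exact habc (fun n hn => hE Q n (hn.trans zero_le_one)) ?_ N (hN Q)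
    have h1 : X (Q + 1) 1 ≠ 0 := by
      rw [hQ, ← Finset.prod_range_succ]
      exact Finset.prod_ne_zero_iff.2 fun i _ => hE i 1 le_rfl
    -- Equality at this step forces `c 0 * c 1 = 1`, so the connecting map out of degree 0 is zero.
    have h2 : X (Q + 1) 1 * (c 0 * c 1) = X (Q + 1) 1 * 1 := by
      calc X (Q + 1) 1 * (c 0 * c 1) = X Q 1 * E Q 1 := by
            rw [(habc 1).1, (habc 1).2.1, (habc 1).2.2, sub_self]
            ring
        _ = X (Q + 1) 1 * 1 := by rw [hQ, hQ', mul_one]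
    exact Nat.eq_one_of_mul_eq_one_right (Nat.eq_of_mul_eq_mul_left (Nat.pos_of_ne_zero h1) h2)

lemma filtration_ne_zero {X E : ℕ → ℤ → ℕ} (hX : ∀ n, X 0 n = 1)
    (h : ∀ q, ∃ a b c : ℤ → ℕ, ∀ n,
      X q n = c (n - 1) * a n ∧ X (q + 1) n = a n * b n ∧ E q n = b n * c n)
    {n : ℤ} (hE : ∀ q, E q n ≠ 0) (q : ℕ) : X q n ≠ 0 := by
  induction q with
  | zero => simp [hX]
  | succ q ih =>
    obtain ⟨a, b, c, habc⟩ := h q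
    have h1 := hE q
    rw [(habc n).1] at ih
    rw [(habc n).2.2] at h1
    rw [(habc n).2.1]
    exact mul_ne_zero (right_ne_zero_of_mul ih) (left_ne_zero_of_mul h1)

/-- Bidegrees are reindexed by row `q + 1` and total degree `-k`; outside the finite window the
column is `< m` and the factor is 1. -/
lemma finprod_halfPlane_eq (g : ℤ × ℕ → ℕ) {m : ℤ} (hg : ∀ (p : ℤ) (q : ℕ), p < m → g (p, q) = 1)
    {N Q : ℕ} (hN : -m < N) (hQ : -m < Q) :
    ∏ᶠ (x : ℤ × ℕ) (_ : x.1 + x.2 ≤ 0 ∧ 0 < x.2),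
      (g x : ℚ) ^ (((x.1 + x.2).negOnePow : ℤˣ) : ℤ) =
    ∏ q ∈ Finset.range Q, altProd N (fun n => g (n - (q + 1 : ℕ), q + 1)) := by
  let ι : ℕ × ℕ → ℤ × ℕ := fun y => (-(y.2 : ℤ) - (y.1 + 1 : ℕ), y.1 + 1)
  have hι : Function.Injective ι := by
    rintro ⟨a, b⟩ ⟨c, d⟩ h
    have h1 := congrArg Prod.fst h
    have h2 := congrArg Prod.snd h
    simp only [ι] at h1 h2
    exact Prod.ext (by simp only; omega) (by simp only; omega)
  rw [finprod_eq_prod_of_mulSupport_subset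
    (s := (Finset.range Q ×ˢ Finset.range N).map ⟨ι, hι⟩)]
  · rw [Finset.prod_map, Finset.prod_product]
    refine Finset.prod_congr rfl fun q _ => Finset.prod_congr rfl fun k _ => ?_
    have h1 : (ι (q, k)).1 + (ι (q, k)).2 = -k := by simp only [ι]; push_cast; ring
    change ∏ᶠ (_ : (ι (q, k)).1 + (ι (q, k)).2 ≤ 0 ∧ 0 < (ι (q, k)).2), _ = _
    rw [finprod_eq_if, if_pos ⟨by rw [h1]; simp, Nat.succ_pos _⟩]
    change (g (ι (q, k)) : ℚ) ^ ((((ι (q, k)).1 + (ι (q, k)).2).negOnePow : ℤˣ) : ℤ) = _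
    rw [h1]
  · rintro ⟨p, q⟩ hx
    rw [Function.mem_mulSupport, finprod_eq_if] at hx
    split_ifs at hx with h
    · have hp : ¬ p < m := fun hp => hx (by rw [hg p q hp, Nat.cast_one, one_zpow])
      simp only at h
      refine Finset.mem_coe.2 (Finset.mem_map.2 ⟨(q - 1, (-(p + q)).toNat), ?_, ?_⟩)
      · rw [Finset.mem_product, Finset.mem_range, Finset.mem_range]
        exact ⟨by simp only; omega, by simp only; omega⟩
      · exact Prod.ext (by simp only [Function.Embedding.coeFn_mk, ι]; omega)
          (by simp only [Function.Embedding.coeFn_mk, ι]; omega)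
    · exact absurd rfl hx

lemma finprod_ne_zero_eq (t : ℤ → ℕ) {m : ℤ} (ht : ∀ i < m, t i = 1) (ht' : ∀ i > 0, t i = 1)
    {N : ℕ} (hN : -m ≤ N) :
    ∏ᶠ (i : ℤ) (_ : i ≠ 0), (t i : ℚ) ^ ((i.negOnePow : ℤˣ) : ℤ) =
    ∏ k ∈ Finset.range N, (t (-(k + 1 : ℕ)) : ℚ) ^ (((-(k + 1 : ℕ) : ℤ).negOnePow : ℤˣ) : ℤ) := by
  let ι : ℕ → ℤ := fun k => -(k + 1 : ℕ)
  have hι : Function.Injective ι := fun a b h => by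
    simp only [ι] at h
    omega
  rw [finprod_eq_prod_of_mulSupport_subset (s := (Finset.range N).map ⟨ι, hι⟩)]
  · rw [Finset.prod_map]
    refine Finset.prod_congr rfl fun k _ => ?_
    rw [finprod_eq_if, if_pos]
    · rfl
    · simp only [Function.Embedding.coeFn_mk, ι]
      omega
  · intro i hi
    rw [Function.mem_mulSupport, finprod_eq_if] at hi
    split_ifs at hi with h
    · have h1 : ¬ i < m := fun h => hi (by rw [ht i h, Nat.cast_one, one_zpow])
      have h2 : ¬ 0 < i := fun h => hi (by rw [ht' i h, Nat.cast_one, one_zpow])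
      refine Finset.mem_coe.2 (Finset.mem_map.2 ⟨(-i - 1).toNat, ?_, ?_⟩)
      · rw [Finset.mem_range]
        omega
      · simp only [Function.Embedding.coeFn_mk, ι]
        omega
    · exact absurd rfl hi

end Numerical

lemma card_eq_one_of_isZero {X : AddCommGrpCat.{u}} (h : IsZero X) : Nat.card X = 1 := by
  have := AddCommGrpCat.subsingleton_of_isZero h
  exact Nat.card_unique

lemma isZero_homology_of_isZero_X {C : Type*} [Category C] [Abelian C] (K : CochainComplex C ℤ)
    {p : ℤ} (h : IsZero (K.X p)) : IsZero (K.homology p) :=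
  (ShortComplex.exact_iff_isZero_homology _).1 (ShortComplex.exact_of_isZero_X₂ _ h)

/-! ### The index formula -/

section IndexFormula

variable {R : Type u} [Ring R] {θ : Ideal R} (P : ProjectiveResolution (quotModule θ))
  {A : CochainComplex (ModuleCat.{u} R) ℤ}

lemma card_cohExt_eq_one {M : ModuleCat.{u} R} {p : ℤ} (h : IsZero (A.X p)) (q : ℕ) :
    Nat.card (cohExt M A p q) = 1 :=
  card_eq_one_of_isZero (isZero_homology_of_isZero_X _
    ((Abelian.extFunctorObj M q).map_isZero h))

lemma card_annComplex_homology_eq_one {p : ℤ} (h : IsZero (A.X p)) :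
    Nat.card ((annComplex θ A).homology p) = 1 :=
  card_eq_one_of_isZero (isZero_homology_of_isZero_X _ ((annFunctor θ).map_isZero h))

lemma exists_card_filtration (q : ℕ) : ∃ a b c : ℤ → ℕ, ∀ n,
    Nat.card (RelH (totalD P.complex A) (dec P.complex A 0) (dec P.complex A q) n) =
      c (n - 1) * a n ∧
    Nat.card (RelH (totalD P.complex A) (dec P.complex A 0) (dec P.complex A (q + 1 : ℕ)) n) =
      a n * b n ∧
    Nat.card (ssE P.complex A 2 (n - (q + 1 : ℕ)) (q + 1 : ℕ)) = b n * c n := by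
  obtain ⟨a, b, c, h⟩ := exists_card_relH (D := totalD P.complex A) totalD_totalD
    (S := dec P.complex A 0) (S' := dec P.complex A q) (S'' := dec P.complex A (q + 1 : ℕ))
    (dec_mono (by omega)) (dec_mono (by omega))
  refine ⟨a, b, c, fun n => ⟨(h n).1, (h n).2.1, ?_⟩⟩
  rw [card_ssE_two, sub_add_cancel, ← (h n).2.2]
  congr 4
  push_cast
  ring

/-- The orders of the relative cohomology groups of the total complex modulo its bottom row. -/
lemma exists_card_relH_dec_zero {m : ℤ} (hA : ∀ i : ℤ, 0 < i → IsZero (A.X i))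
    (hm : ∀ i : ℤ, i < m → IsZero (A.X i)) (hac : ∀ i : ℤ, i ≠ 0 → IsZero (A.homology i)) :
    (∀ i < 0, Nat.card ((annComplex θ A).homology i) =
      Nat.card (RelH (totalD P.complex A) (dec P.complex A 0) (fil P.complex A m) (i - 1))) ∧
    Nat.card (RelH (totalD P.complex A) (dec P.complex A 0) (fil P.complex A m) 1) =
      Nat.card (Abelian.Ext (quotModule θ) (A.homology 0) 1) := by
  obtain ⟨a, b, c, h⟩ := exists_card_relH (D := totalD P.complex A) totalD_totalD
    (S := dec P.complex A (-1)) (S' := dec P.complex A 0) (S'' := fil P.complex A m)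
    (dec_mono (by omega)) (fun n f hf => mem_fil_of_le hA hm le_rfl hf.1)
  -- The total complex has no cohomology in negative degrees, so there the connecting maps are
  -- bijective.
  have hb : ∀ n < 0, a n = 1 ∧ b n = 1 := fun n hn => by
    have h1 := (h n).2.1
    rw [card_relH_fil_of_neg P hA hm hac hn] at h1
    exact ⟨Nat.eq_one_of_mul_eq_one_right h1.symm, Nat.eq_one_of_mul_eq_one_left h1.symm⟩
  constructor
  · intro i hi
    rw [← card_relH_dec_zero P hA hm i, (h i).1, (h (i - 1)).2.2, (hb i hi).1,
      (hb (i - 1) (by omega)).2, mul_one, one_mul]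
  -- `A^θ` has no cohomology in degrees 1 and 2, so passing to the quotient does not change the
  -- order of `H^1`.
  · have h1 := (h 1).1
    have h2 := (h 2).1
    rw [card_relH_dec_zero P hA hm, card_annComplex_homology_eq_one (hA _ (by omega))] at h1 h2
    have h3 := Nat.eq_one_of_mul_eq_one_left h1.symm
    have h4 : c 1 = 1 := Nat.eq_one_of_mul_eq_one_right h2.symm
    rw [← card_relH_fil_one P hA hm hac, (h 1).2.2, (h 1).2.1, h3, h4, mul_one, one_mul]

/-- Torsion maps to zero in the torsion-free `H^0(A)`; conversely a finite kernel consists of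
torsion elements. -/
lemma torsion_eq_ker (hA : ∀ (k : ℤ) (x : A.homology 0), k • x = 0 → k = 0 ∨ x = 0)
    (h : Finite (annHomologyMap θ A 0).ker) :
    indexTor θ A = (annHomologyMap θ A 0).ker := by
  ext x
  constructor
  · intro hx
    obtain ⟨n, hn, h1⟩ := isOfFinAddOrder_iff_nsmul_eq_zero.1 hx
    have h2 : n • annHomologyMap θ A 0 x = 0 := by rw [← map_nsmul, h1, map_zero]
    have h3 : (n : ℤ) • (annHomologyMap θ A 0 x : A.homology 0) = 0 := by
      rw [natCast_zsmul]
      exact congrArg Subtype.val h2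
    exact Subtype.ext ((hA n _ h3).resolve_left (by omega))
  · intro hx
    have h1 := isOfFinAddOrder_of_finite (⟨x, hx⟩ : (annHomologyMap θ A 0).ker)
    exact (annHomologyMap θ A 0).ker.subtype.isOfFinAddOrder h1

theorem index_formula (P : ProjectiveResolution (quotModule θ)) {m : ℤ} (hm0 : m ≤ 0) (hA : ∀ i : ℤ, 0 < i → IsZero (A.X i))
    (hm : ∀ i : ℤ, i < m → IsZero (A.X i)) (hac : ∀ i : ℤ, i ≠ 0 → IsZero (A.homology i))
    (htf : ∀ (k : ℤ) (x : A.homology 0), k • x = 0 → k = 0 ∨ x = 0)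
    (hfin : ∀ (p : ℤ) (q : ℕ), 0 < q → p + q ≤ 1 → Finite (cohExt (quotModule θ) A p q))
    (hext : Nat.card (Abelian.Ext (quotModule θ) (A.homology 0) 1) =
      ∏ᶠ q : ℕ, Nat.card (cohExt (quotModule θ) A (1 - q) q)) :
    Finite (indexCoker θ A) ∧ Finite (indexTor θ A) ∧
      index θ A = ∏ᶠ (x : ℤ × ℕ) (_ : x.1 + x.2 ≤ 0 ∧ 0 < x.2),
        (Nat.card (cohExt (quotModule θ) A x.1 x.2) : ℚ) ^
          (((x.1 + x.2).negOnePow : ℤˣ) : ℤ) := by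
  let M := quotModule θ
  let D := totalD P.complex A
  obtain ⟨l, hl⟩ := Int.eq_ofNat_of_zero_le (neg_nonneg.2 hm0)
  -- With `m = -l`: `Q` makes `dec Q` the whole complex in degrees `≤ 1`, and `-N < m` makes the
  -- graded pieces vanish in degree `-N`. `N = l + 2` leaves `l` factors, for `H^{-1}, …, H^{-l}` of
  -- `A^θ`, once degrees 0 and -1 are split off.
  let Q := l + 3
  let N := l + 2
  let E : ℕ → ℤ → ℕ := fun q n => Nat.card (cohExt M A (n - (q + 1 : ℕ)) (q + 1))
  let X : ℕ → ℤ → ℕ := fun q n =>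
    Nat.card (RelH D (dec P.complex A 0) (dec P.complex A q) n)
  let y : ℤ → ℕ := fun n => Nat.card (RelH D (dec P.complex A 0) (fil P.complex A m) n)
  have hX : ∀ n, X 0 n = 1 := fun n => card_subquot_eq_one fun f hf => mem_relB.2
    ⟨f, hf.1, 0, zero_mem _, by simp⟩
  have hstep : ∀ q, ∃ a b c : ℤ → ℕ, ∀ n,
      X q n = c (n - 1) * a n ∧ X (q + 1) n = a n * b n ∧ E q n = b n * c n := fun q => by
    obtain ⟨a, b, c, h⟩ := exists_card_filtration P (A := A) q
    refine ⟨a, b, c, fun n => ⟨(h n).1, (h n).2.1, ?_⟩⟩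
    rw [← (h n).2.2, card_ssE_two_eq_card_cohExt P hA hm _ (Nat.succ_pos q)]
  have hE : ∀ q, ∀ n ≤ 1, E q n ≠ 0 := fun q n hn => by
    have := hfin (n - (q + 1 : ℕ)) (q + 1) (Nat.succ_pos q) (by omega)
    exact Nat.card_ne_zero.2 ⟨⟨0⟩, this⟩
  have hE1 : ∀ q n, n < m → E q n = 1 := fun q n hn =>
    card_cohExt_eq_one (hm _ (by omega)) _
  have hXy : ∀ n ≤ 1, X Q n = y n := fun n hn =>
    relH_congr (dec_eq_fil hA hm (by omega)) (dec_eq_fil hA hm (by omega))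
  obtain ⟨hy, hy1⟩ := exists_card_relH_dec_zero P hA hm hac
  have hQ : X Q 1 = ∏ q ∈ Finset.range Q, E q 1 := by
    rw [hXy 1 le_rfl]
    refine hy1.trans (hext.trans ?_)
    rw [finprod_eq_prod_of_mulSupport_subset (s := Finset.range (Q + 1)), Finset.prod_range_succ']
    -- The factor `q = 0` sits in degree `p = 1`, where `A` is zero.
    · have h0 : Nat.card (cohExt M A (1 - (0 : ℕ)) 0) = 1 :=
        card_cohExt_eq_one (hA _ (by simp)) _
      rw [h0, mul_one]
    · intro q hq
      rw [Finset.mem_coe, Finset.mem_range]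
      by_contra hq'
      exact hq (card_cohExt_eq_one (hm _ (by omega)) _)
  have hprod := altProd_filtration hX hstep hE (N := N) (fun q => hE1 q _ (by omega)) Q hQ
  have hy0 : ∀ n ≤ 0, y n ≠ 0 := fun n hn => by
    rw [← hXy n (by omega)]
    exact filtration_ne_zero hX hstep (fun q => hE q n (by omega)) Q
  have hcoker : y 0 = Nat.card (indexCoker θ A) := card_indexCoker P hA hm hac
  have hker : y (-1) = Nat.card (annHomologyMap θ A 0).ker :=
    card_ker_annHomologyMap P hA hm hac
  have hcokerFin : Finite (indexCoker θ A) := (Nat.card_ne_zero.1 (hcoker ▸ hy0 0 le_rfl)).2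
  have hkerFin : Finite (annHomologyMap θ A 0).ker :=
    (Nat.card_ne_zero.1 (hker ▸ hy0 (-1) (by omega))).2
  have htor := torsion_eq_ker htf hkerFin
  refine ⟨hcokerFin, htor ▸ hkerFin, ?_⟩
  rw [finprod_halfPlane_eq (fun x => Nat.card (cohExt M A x.1 x.2))
    (fun p q hp => card_cohExt_eq_one (hm p hp) q) (N := N) (Q := Q) (by omega) (by omega)]
  refine Eq.trans ?_ hprod
  rw [altProd_congr N fun n hn => hXy n (by omega), index, htor, ← hcoker, ← hker,
    finprod_ne_zero_eq (fun i => Nat.card ((annComplex θ A).homology i))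
      (fun i hi => card_annComplex_homology_eq_one (hm i hi))
      (fun i hi => card_annComplex_homology_eq_one (hA i hi)) (N := l) (by omega), altProd,
    Finset.prod_range_succ', Finset.prod_range_succ']
  -- The degree shift of the connecting isomorphism reverses the sign, which accounts for these
  -- groups being in the denominator of the index.
  have h1 : ∀ k : ℕ, ((Nat.card ((annComplex θ A).homology (-(k + 1 : ℕ))) : ℕ) : ℚ) ^
      (((-(k + 1 : ℕ) : ℤ).negOnePow : ℤˣ) : ℤ) =
      ((y (-(k + 1 + 1 : ℕ)) : ℚ) ^ (((-(k + 1 + 1 : ℕ) : ℤ).negOnePow : ℤˣ) : ℤ))⁻¹ := fun k => by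
    have h2 : (-(k + 1 : ℕ) : ℤ) - 1 = -(k + 1 + 1 : ℕ) := by push_cast; ring
    rw [hy _ (by omega), h2, ← h2, Int.negOnePow_sub, Int.negOnePow_one, mul_neg, mul_one,
      Units.val_neg, zpow_neg, inv_inv]
  rw [Finset.prod_congr rfl fun k _ => h1 k, Finset.prod_inv_distrib]
  have h3 : (y (-1) : ℚ) ≠ 0 := by exact_mod_cast hy0 (-1) (by omega)
  have h4 : ((((-((0 + 1 : ℕ) : ℤ)).negOnePow : ℤˣ)) : ℤ) = -1 := by simp
  have h5 : ((((-((0 : ℕ) : ℤ)).negOnePow : ℤˣ)) : ℤ) = 1 := by simp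
  rw [h4, h5, zpow_neg, zpow_one, zpow_one, div_eq_mul_inv, mul_inv, inv_inv]
  simp only [zero_add, Nat.cast_one, Nat.cast_zero, neg_zero]
  ring

end IndexFormula

lemma finite_of_fg_of_zsmul_eq_zero (X : Type*) [AddCommGroup X] [Module.Finite ℤ X] {c : ℤ}
    (hc : c ≠ 0) (h : ∀ x : X, c • x = 0) : Finite X :=
  Module.finite_of_fg_torsion X fun {x} => ⟨⟨c, mem_nonZeroDivisors_of_ne_zero hc⟩, h x⟩

/-! ### Semisimplicity of the rational group algebra, integrally -/

section Integral

variable {G : Type u} [Group G]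

lemma exists_zsmul_eq_map (r : MonoidAlgebra ℚ G) :
    ∃ k : ℤ, k ≠ 0 ∧ ∃ s : MonoidAlgebra ℤ G,
      k • r = MonoidAlgebra.mapRingHom G (Int.castRingHom ℚ) s := by
  induction r using MonoidAlgebra.induction_linear with
  | zero => exact ⟨1, one_ne_zero, 0, by simp⟩
  | add f g hf hg =>
    obtain ⟨k, hk, s, hs⟩ := hf
    obtain ⟨l, hl, t, ht⟩ := hg
    refine ⟨k * l, mul_ne_zero hk hl, l • s + k • t, ?_⟩
    rw [map_add, map_zsmul, map_zsmul, ← hs, ← ht, smul_add, smul_smul, smul_smul, mul_comm l k]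
  | single g a =>
    refine ⟨a.den, by exact_mod_cast a.den_nz, MonoidAlgebra.single g a.num, ?_⟩
    rw [MonoidAlgebra.mapRingHom_single, MonoidAlgebra.smul_single]
    congr 1
    rw [zsmul_eq_mul]
    exact_mod_cast (mul_comm _ _).trans (Rat.mul_den_eq_num a)

/-- Integral form of the semisimplicity of the rational group algebra: up to a nonzero integer,
`R/θ` is a direct summand of `R = ℤ[G]`. -/
lemma exists_mul_eq_zero_and_sub_mem [Finite G] (θ : Ideal (MonoidAlgebra ℤ G)) :
    ∃ (c : ℤ) (e : MonoidAlgebra ℤ G), c ≠ 0 ∧ (∀ t ∈ θ, t * e = 0) ∧ e - c ∈ θ := by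
  let f := MonoidAlgebra.mapRingHom G (Int.castRingHom ℚ)
  have hf : Function.Injective f := MonoidAlgebra.map_injective _ Int.cast_injective
  -- `I` is the rational span of `θ`, described by common denominators.
  let I : Ideal (MonoidAlgebra ℚ G) :=
    { carrier := {x | ∃ n : ℤ, n ≠ 0 ∧ ∃ t ∈ θ, n • x = f t}
      zero_mem' := ⟨1, one_ne_zero, 0, zero_mem _, by simp⟩
      add_mem' := by
        rintro x y ⟨n, hn, s, hs, hx⟩ ⟨k, hk, t, ht, hy⟩
        refine ⟨n * k, mul_ne_zero hn hk, k • s + n • t,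
          add_mem (zsmul_mem hs k) (zsmul_mem ht n), ?_⟩
        rw [map_add, map_zsmul, map_zsmul, ← hx, ← hy, smul_add, smul_smul, smul_smul, mul_comm k n]
      smul_mem' := by
        rintro r x ⟨n, hn, t, ht, hx⟩
        obtain ⟨k, hk, s, hs⟩ := exists_zsmul_eq_map r
        refine ⟨k * n, mul_ne_zero hk hn, s * t, θ.mul_mem_left s ht, ?_⟩
        rw [map_mul, ← hx, ← hs, smul_eq_mul, smul_mul_smul_comm] }
  obtain ⟨ε, hε, hI⟩ := IsSemisimpleRing.ideal_eq_span_idempotent I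
  obtain ⟨n, hn, t₀, ht₀, h⟩ : ε ∈ I := hI ▸ Ideal.subset_span rfl
  -- `e = n - t₀` maps to `n(1 - ε)`, and `1 - ε` is killed on the left by `I`.
  refine ⟨n, n - t₀, hn, fun t ht => hf ?_, ?_⟩
  · have h1 : f t ∈ I := ⟨1, one_ne_zero, t, ht, one_smul _ _⟩
    rw [hI, Ideal.mem_span_singleton'] at h1
    obtain ⟨r, hr⟩ := h1
    have h2 : f t * ε = f t := by rw [← hr, mul_assoc, hε.eq]
    rw [map_mul, map_sub, ← h, map_intCast, mul_sub, mul_smul_comm, h2, map_zero, sub_eq_zero,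
      zsmul_eq_mul]
    exact ((Int.cast_commute n (f t)).eq).symm
  · rw [sub_sub_cancel_left]
    exact neg_mem ht₀

end Integral

/-! ### Finiteness of the groups for finite `G` -/

section Finiteness

variable {R : Type u} [Ring R]

lemma finite_hom_of_finite [Module.Finite ℤ R] (M N : ModuleCat.{u} R) [Module.Finite R M]
    [Module.Finite R N] : Module.Finite ℤ (M ⟶ N) := by
  have : Module.Finite ℤ N := Module.Finite.trans R N
  obtain ⟨n, s, hs⟩ := Module.Finite.exists_fin (R := R) (M := M)
  let φ : (M ⟶ N) →+ (Fin n → N) :=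
    { toFun := fun f i => f (s i)
      map_zero' := rfl
      map_add' := fun _ _ => rfl }
  refine Module.Finite.of_injective φ.toIntLinearMap fun f g h => ?_
  exact ModuleCat.hom_ext (LinearMap.ext_on_range hs fun i => congrFun h i)

/-- Dimension shifting along a finite free cover of `M`, whose kernel is again finitely generated
because `R` is noetherian. -/
lemma finite_ext_of_finite [Module.Finite ℤ R] (q : ℕ) (M N : ModuleCat.{u} R) [Module.Finite R M]
    [Module.Finite R N] : Module.Finite ℤ (Abelian.Ext M N q) := by
  have : IsNoetherianRing R :=
    isNoetherian_of_tower ℤ (isNoetherian_of_isNoetherianRing_of_finite ℤ _)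
  induction q generalizing M with
  | zero =>
    have := finite_hom_of_finite M N
    exact Module.Finite.equiv (Abelian.Ext.addEquiv₀ (X := M) (Y := N)).symm.toIntLinearEquiv
  | succ q ih =>
    obtain ⟨n, f, hf⟩ := Module.Finite.exists_fin' R M
    have hS := LinearMap.shortExact_shortComplexKer hf
    have : Projective f.shortComplexKer.X₂ :=
      ModuleCat.projective_of_free (M := ModuleCat.of R (Fin n → R)) (Pi.basisFun R (Fin n))
    have := ih f.shortComplexKer.X₁
    exact Module.Finite.of_surjective (hS.extClass.precomp N (add_comm 1 q)).toIntLinearMap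
      (precomp_extClass_surjective_of_projective_X₂ N hS q)

variable {θ : Ideal R} {c : ℤ} {e : R}

/-- Right multiplication by `e` induces `R/θ → R`; followed by the projection it is multiplication
by `c`, which thus factors through a projective module. -/
lemma zsmul_ext_eq_zero (he : ∀ t ∈ θ, t * e = 0) (hce : e - c ∈ θ) {N : ModuleCat.{u} R} {q : ℕ}
    (x : Abelian.Ext (quotModule θ) N (q + 1)) : c • x = 0 := by
  let s : quotModule θ ⟶ ModuleCat.of R R :=
    ModuleCat.ofHom (Submodule.liftQ θ (LinearMap.toSpanSingleton R R e) he)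
  let π : ModuleCat.of R R ⟶ quotModule θ := ModuleCat.ofHom (Submodule.mkQ θ)
  have hsπ : s ≫ π = c • 𝟙 (quotModule θ) := by
    refine ModuleCat.hom_ext (LinearMap.ext fun y => ?_)
    obtain ⟨r, rfl⟩ := Submodule.Quotient.mk_surjective θ y
    change (Submodule.Quotient.mk (r * e) : R ⧸ θ) = c • Submodule.Quotient.mk r
    rw [← Submodule.Quotient.mk_smul, Submodule.Quotient.eq, zsmul_eq_mul, Int.cast_comm, ← mul_sub]
    exact θ.mul_mem_left r hce
  have hproj : Projective (ModuleCat.of R R) :=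
    ModuleCat.projective_of_free (Module.Basis.singleton Unit R)
  have h1 : (Abelian.Ext.mk₀ (s ≫ π)).comp x (zero_add _) = 0 := by
    rw [← Abelian.Ext.mk₀_comp_mk₀, Abelian.Ext.comp_assoc _ _ _ (zero_add 0) (zero_add _) (by simp),
      Abelian.Ext.eq_zero_of_projective ((Abelian.Ext.mk₀ π).comp x (zero_add _)),
      Abelian.Ext.comp_zero]
  let φ : (quotModule θ ⟶ quotModule θ) →+ Abelian.Ext (quotModule θ) N (q + 1) :=
    (x.postcomp (quotModule θ) (zero_add _)).comp Abelian.Ext.addEquiv₀.symm.toAddMonoidHom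
  have h2 : φ (c • 𝟙 (quotModule θ)) = c • φ (𝟙 _) := map_zsmul φ c _
  have h3 : φ (𝟙 _) = x := Abelian.Ext.mk₀_id_comp x
  rw [← h3, ← h2, ← hsπ]
  exact h1

lemma finite_ext_quotModule [Module.Finite ℤ R] (hc : c ≠ 0) (he : ∀ t ∈ θ, t * e = 0)
    (hce : e - c ∈ θ) (N : ModuleCat.{u} R) [Module.Finite R N] {q : ℕ} (hq : 0 < q) :
    Finite (Abelian.Ext (quotModule θ) N q) := by
  obtain ⟨q, rfl⟩ := Nat.exists_eq_succ_of_ne_zero hq.ne'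
  have := finite_ext_of_finite (q + 1) (quotModule θ) N
  exact finite_of_fg_of_zsmul_eq_zero _ hc fun x => zsmul_ext_eq_zero he hce x

lemma finite_homology_of_finite (K : CochainComplex AddCommGrpCat.{u} ℤ) (p : ℤ)
    (h : Finite (K.X p)) : Finite (K.homology p) := by
  have : Finite (K.cycles p) := Finite.of_injective _ (iCycles_injective K p)
  exact Finite.of_surjective _ (homologyπ_surjective K p)

theorem finite_cohExt [Module.Finite ℤ R] (hc : c ≠ 0) (he : ∀ t ∈ θ, t * e = 0)
    (hce : e - c ∈ θ) (A : CochainComplex (ModuleCat.{u} R) ℤ)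
    (hA : ∀ p : ℤ, Module.Finite R (A.X p)) (p : ℤ) {q : ℕ} (hq : 0 < q) :
    Finite (cohExt (quotModule θ) A p q) :=
  finite_homology_of_finite _ p (finite_ext_quotModule hc he hce (A.X p) hq)

/-- If `x` is a cocycle of `A^θ` and `x = d y` in `A`, then `e y` is killed by `θ` and `d (e y) = e
x = c x`, so `c` kills the cohomology. -/
theorem finite_annComplex_homology [Module.Finite ℤ R] (hc : c ≠ 0) (he : ∀ t ∈ θ, t * e = 0)
    (hce : e - c ∈ θ) (A : CochainComplex (ModuleCat.{u} R) ℤ)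
    (hA : ∀ p : ℤ, Module.Finite R (A.X p)) (i : ℤ) (hi : IsZero (A.homology i)) :
    Finite ((annComplex θ A).homology i) := by
  let K := annComplex θ A
  have h1 : Module.Finite ℤ (A.X i) := Module.Finite.trans R (A.X i)
  have h2 : Module.Finite ℤ (annihilated θ (A.X i)) :=
    Module.Finite.of_injective (annihilated θ (A.X i)).subtype.toIntLinearMap
      Subtype.val_injective
  have h3 : Module.Finite ℤ (K.X i) := h2
  have h4 : Module.Finite ℤ (K.cycles i) :=
    Module.Finite.of_injective (K.iCycles i).hom.toIntLinearMap (iCycles_injective K i)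
  have h5 : Module.Finite ℤ (K.homology i) :=
    Module.Finite.of_surjective (K.homologyπ i).hom.toIntLinearMap (homologyπ_surjective K i)
  refine finite_of_fg_of_zsmul_eq_zero _ hc fun x => ?_
  obtain ⟨z, rfl⟩ := homologyπ_surjective K i x
  rw [← map_zsmul, homologyπ_eq_zero_iff K (sub_add_cancel i 1), map_zsmul]
  have hz := d_iCycles_apply K i (i + 1) z
  obtain ⟨⟨x, hx⟩, hxz⟩ : ∃ x : annihilated θ (A.X i), K.iCycles i z = x := ⟨_, rfl⟩
  rw [hxz] at hz ⊢
  have hdx : A.d i (i + 1) x = 0 := congrArg Subtype.val hz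
  have hex : A.ExactAt i := (A.exactAt_iff_isZero_homology i).2 hi
  rw [A.exactAt_iff' (i - 1) i (i + 1) (by simp) (by simp)] at hex
  obtain ⟨y, hy⟩ := (ShortComplex.moduleCat_exact_iff _).1 hex x hdx
  change A.X (i - 1) at y
  change A.d (i - 1) i y = x at hy
  have hey : e • y ∈ annihilated θ (A.X (i - 1)) := fun t ht => by
    rw [smul_smul, he t ht, zero_smul]
  refine ⟨(⟨e • y, hey⟩ : annihilated θ (A.X (i - 1))), Subtype.ext ?_⟩
  change A.d (i - 1) i (e • y) = c • x
  have hex' := hx _ hce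
  rw [sub_smul, sub_eq_zero, Int.cast_smul_eq_zsmul] at hex'
  rw [map_smul, hy, hex']

end Finiteness

end SinnottIndex

end

theorem mainTheorem9 {G : Type u} [Group G]
    (θ : Ideal (MonoidAlgebra ℤ G))
    (A : CochainComplex (ModuleCat.{u} (MonoidAlgebra ℤ G)) ℤ)
    (hA_pos : ∀ i : ℤ, 0 < i → IsZero (A.X i))
    (hA_neg : ∃ n : ℤ, ∀ i : ℤ, i < n → IsZero (A.X i))
    (hA_acyclic : ∀ i : ℤ, i ≠ 0 → IsZero (A.homology i))
    (hA_torsionfree : ∀ (k : ℤ) (x : A.homology 0), k • x = 0 → k = 0 ∨ x = 0)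
    (P : ProjectiveResolution (SinnottIndex.quotModule θ)) :
    -- if `G` is finite and all `A^p` are finitely generated, all relevant groups are finite
    (Finite G → (∀ p : ℤ, Module.Finite (MonoidAlgebra ℤ G) (A.X p)) →
      (∀ i : ℤ, i ≠ 0 → Finite ((SinnottIndex.annComplex θ A).homology i)) ∧
      (∀ (p : ℤ) (q : ℕ), 0 < q →
        Finite (SinnottIndex.cohExt (SinnottIndex.quotModule θ) A p q))) ∧
    -- if the relevant groups are finite, the index formula holds
    ((∀ i : ℤ, i ≠ 0 → Finite ((SinnottIndex.annComplex θ A).homology i)) →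
      (∀ (p : ℤ) (q : ℕ), 0 < q → p + q ≤ 1 →
        Finite (SinnottIndex.cohExt (SinnottIndex.quotModule θ) A p q)) →
      Nat.card (Abelian.Ext (SinnottIndex.quotModule θ) (A.homology 0) 1) =
        ∏ᶠ q : ℕ, Nat.card (SinnottIndex.cohExt (SinnottIndex.quotModule θ) A (1 - q) q) →
      Finite (SinnottIndex.indexCoker θ A) ∧
      Finite (SinnottIndex.indexTor θ A) ∧
      SinnottIndex.index θ A =
        (∏ᶠ (x : ℤ × ℕ) (_ : x.1 + x.2 ≤ 0 ∧ 0 < x.2),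
          (Nat.card (SinnottIndex.cohExt (SinnottIndex.quotModule θ) A x.1 x.2) : ℚ) ^
            (((x.1 + x.2).negOnePow : ℤˣ) : ℤ)) ∧
      SinnottIndex.index θ A =
        (∏ᶠ (x : ℤ × ℕ) (_ : x.1 + x.2 ≤ 0 ∧ 0 < x.2),
          (Nat.card (SinnottIndex.ssE P.complex A 2 x.1 x.2) : ℚ) ^
            (((x.1 + x.2).negOnePow : ℤˣ) : ℤ))) := by
  constructor
  · intro _ hfg
    obtain ⟨c, e, hc, he, hce⟩ := SinnottIndex.exists_mul_eq_zero_and_sub_mem θ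
    exact ⟨fun i hi => SinnottIndex.finite_annComplex_homology hc he hce A hfg i (hA_acyclic i hi),
      fun p q hq => SinnottIndex.finite_cohExt hc he hce A hfg p hq⟩
  · intro _ hfin hext
    obtain ⟨n, hn⟩ := hA_neg
    -- `index_formula` needs a nonpositive lower bound, hence the minimum with 0.
    have hm : ∀ i : ℤ, i < min n 0 → IsZero (A.X i) := fun i hi => hn i (by omega)
    obtain ⟨h1, h2, h3⟩ := SinnottIndex.index_formula P (min_le_right n 0) hA_pos hm hA_acyclic
      hA_torsionfree hfin hext
    refine ⟨h1, h2, h3, h3.trans (finprod_congr fun x => finprod_congr fun hx => ?_)⟩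
    rw [SinnottIndex.card_ssE_two_eq_card_cohExt P hA_pos hm x.1 hx.2]
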